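/- A \emph{graph class} is a nonempty collection $\mathcal{P}$ of finite simple graphs closed under isomorphism; it is \emph{hereditary} if $G\in\mathcal{P}$ implies $G[U]\in\mathcal{P}$ for every nonempty $U\subseteq V(G)$. For a graph $G$, a \emph{maximal $\mathcal{P}$ set} of $G$ is a set $U\subseteq V(G)$ such that $G[U]\in\mathcal{P}$ and $G[W]\notin\mathcal{P}$ for every $W$ with $U\subsetneq W\subseteq V(G)$. The \emph{maximal induced $\mathcal{P}$ subgraphs problem} asks, given a finite graph $G$ (by its adjacency matrix), to output all maximal $\mathcal{P}$ sets of $G$ (by their characteristic vectors), each exactly once. Let $n=|V(G)|$ and let $N$ be the number of maximal $\mathcal{P}$ sets of $G$. The problem is solvable - in \emph{polynomial total time} if there are an algorithm (a deterministic multi-stack Turing machine that outputs the solutions one after another) solving it and a polynomial $p$ such that on every input $G$ the algorithm outputs all solutions and halts within $p(n,N)$ steps; - in \emph{incremental polynomial time} if there are such an algorithm solving it and a polynomial $p$ such that on every input $G$ and for every $1\le s\le N$ the $s$-th solution is output within the first $p(n,s)$ steps, and the algorithm halts within $p(n,N)$ steps. **Theorem.** For every hereditary graph class $\mathcal{P}$,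 the maximal induced $\mathcal{P}$ subgraphs problem is solvable in polynomial total time if and only if it is solvable in incremental polynomial time. -/

import Mathlib

/-! ### Graph classes and maximal `P` sets -/

/-- A graph class: a nonempty collection of finite simple graphs, closed under isomorphism. -/
structure GraphClass where
  /-- membership of a finite graph in the class -/
  Mem : ∀ {V : Type} [Finite V], SimpleGraph V → Prop
  iso_closed : ∀ {V W : Type} [Finite V] [Finite W] (G : SimpleGraph V) (H : SimpleGraph W),
    Nonempty (G ≃g H) → Mem G → Mem H
  nonempty : ∃ (V : Type) (_ : Finite V) (G : SimpleGraph V), Mem G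

namespace GraphClass

/-- A graph class is hereditary if it is closed under taking induced subgraphs
(on nonempty sets of vertices). -/
def Hereditary (P : GraphClass) : Prop :=
  ∀ {V : Type} [Finite V] (G : SimpleGraph V) (U : Set V), U.Nonempty → P.Mem G →
    P.Mem (G.induce U)

/-- `U` is a `P` set of `G` if the subgraph of `G` induced by `U` belongs to the class `P`. -/
def IsSetOf (P : GraphClass) {V : Type} [Finite V] (G : SimpleGraph V) (U : Set V) : Prop :=
  P.Mem (G.induce U)

/-- `U` is a maximal `P` set of `G`: it is a `P` set and no proper superset of it is one. -/
def IsMaximalSetOf (P : GraphClass) {V : Type} [Finite V] (G : SimpleGraph V) (U : Set V) : Prop :=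
  P.IsSetOf G U ∧ ∀ W : Set V, U ⊂ W → ¬ P.IsSetOf G W

/-- The number `N` of solutions, i.e. of maximal `P` sets of `G`. -/
noncomputable def numSolutions (P : GraphClass) {V : Type} [Finite V] (G : SimpleGraph V) : ℕ :=
  {U : Set V | P.IsMaximalSetOf G U}.ncard

end GraphClass

/-! ### Encodings of inputs and outputs -/

open Classical in
/-- The input word of a graph on the vertex set `Fin n`: the rows of its adjacency matrix in order,
every row being followed by the separator `none`. -/
noncomputable def graphCode {n : ℕ} (G : SimpleGraph (Fin n)) : List (Option Bool) :=
  (List.finRange n).flatMap fun i =>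
    (List.finRange n).map (fun j => some (decide (G.Adj i j))) ++ [none]

open Classical in
/-- The output word of a set of vertices: its characteristic vector, of length `n`. -/
noncomputable def vertexSetCode {n : ℕ} (U : Set (Fin n)) : List Bool :=
  (List.finRange n).map fun i => decide (i ∈ U)

/-! ### Enumeration algorithms -/

/-- An enumeration machine: a deterministic multi-stack Turing machine that reads its input word
(over the alphabet `Option Bool`) from its input stack. Some of its control labels are marked as
output labels. Whenever the control is at such a label, the machine outputs one word over `Bool`,
namely the word that its output stack then holds, read from the top of the stack. -/
structure EnumMachine extends Turing.FinTM2 where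
  /-- all stack alphabets are finite -/
  finite_alphabet : ∀ k, Finite (Γ k)
  /-- the alphabet of the input stack -/
  inputAlphabet : Γ k₀ ≃ Option Bool
  /-- the alphabet of the output stack -/
  outputAlphabet : Γ k₁ ≃ Bool
  /-- the marked output labels -/
  emit : Λ → Bool

namespace EnumMachine

/-- The configuration of `M` on the input word `w` after `t` steps
(`none` if `M` has halted in fewer than `t` steps). -/
def cfgAt (M : EnumMachine) (w : List (Option Bool)) : ℕ → Option M.toFinTM2.Cfg
  | 0 => some (Turing.initList M.toFinTM2 (w.map M.inputAlphabet.symm))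
  | t + 1 => (M.cfgAt w t).bind M.toFinTM2.step

/-- The word that a configuration outputs, if its label is an output label. -/
def emitted (M : EnumMachine) (c : M.toFinTM2.Cfg) : Option (List Bool) :=
  match Turing.TM2.Cfg.l c with
  | none => none
  | some l => if M.emit l then some ((Turing.TM2.Cfg.stk c M.k₁).map M.outputAlphabet) else none

/-- The list of all words that `M` outputs on the input word `w` within its first `t` steps,
in the order of their output. -/
def outputs (M : EnumMachine) (w : List (Option Bool)) (t : ℕ) : List (List Bool) :=
  (List.range (t + 1)).filterMap fun u => (M.cfgAt w u).bind M.emitted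

/-- `M` halts on the input word `w` within `t` steps. -/
def HaltsWithin (M : EnumMachine) (w : List (Option Bool)) (t : ℕ) : Prop :=
  ∃ u ≤ t, ∃ c, M.cfgAt w u = some c ∧ Turing.TM2.Cfg.l c = none

/-- On the input graph `G`, the machine `M` halts within `t` steps, having output every
maximal `P` set of `G` exactly once, and nothing else. -/
def EnumeratesWithin (M : EnumMachine) (P : GraphClass) {n : ℕ} (G : SimpleGraph (Fin n))
    (t : ℕ) : Prop :=
  M.HaltsWithin (graphCode G) t ∧ (M.outputs (graphCode G) t).Nodup ∧
    ∀ x, x ∈ M.outputs (graphCode G) t ↔ ∃ U, P.IsMaximalSetOf G U ∧ vertexSetCode U = x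

end EnumMachine

/-! ### Solvability -/

namespace GraphClass

/-- The maximal induced `P` subgraphs problem is solvable in polynomial total time: some machine
enumerates the maximal `P` sets of every graph and halts within a number of steps bounded by a
polynomial in the number `n` of vertices and the number `N` of solutions. -/
def SolvableInPolynomialTotalTime (P : GraphClass) : Prop :=
  ∃ (M : EnumMachine) (p : MvPolynomial (Fin 2) ℕ), ∀ (n : ℕ) (G : SimpleGraph (Fin n)),
    M.EnumeratesWithin P G (MvPolynomial.eval ![n, P.numSolutions G] p)

/-- The maximal induced `P` subgraphs problem is solvable in incremental polynomial time: some
machine enumerates the maximal `P` sets of every graph in such a way that, for `1 ≤ s ≤ N`, the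
`s`-th solution is output within a number of steps bounded by a polynomial in `n` and `s`; after
the `N`-th solution the machine halts, within the bound for `s = N`. -/
def SolvableInIncrementalPolynomialTime (P : GraphClass) : Prop :=
  ∃ (M : EnumMachine) (p : MvPolynomial (Fin 2) ℕ), ∀ (n : ℕ) (G : SimpleGraph (Fin n)),
    (∀ s, 1 ≤ s → s ≤ P.numSolutions G →
      s ≤ (M.outputs (graphCode G) (MvPolynomial.eval ![n, s] p)).length) ∧
    M.EnumeratesWithin P G (MvPolynomial.eval ![n, P.numSolutions G] p)

end GraphClass

/-!
Only the passage from polynomial total time to incremental polynomial time needs an argument. Let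
`M` enumerate the maximal `P` sets of every graph within `p(n, N)` steps. A stage with step budget
`T` runs `M` on induced subgraphs `G[S]` for at most `T` steps each. The solutions of `G[S]` that
are output in such a run are extended greedily to maximal `P` sets of `G`, and the new ones among
these are reported. Membership in `P` is decided by `M` itself: a graph in `P` has only one
solution, so a budget of `p(m, 1)` steps suffices.

A stage first takes `S = V(G)`. If `M` halts, then every solution has been reported. Otherwise
vertices are removed one by one to obtain a minimal `K` such that `M` does not halt on `G[K]` within
`T` steps. Since `M` halts on every `G[K \ {v}]`, every `P` set that is properly contained in `K`
lies in a reported set, and `G[K]` is not in `P`. So, by heredity, distinct solutions of `G[K]` lie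
in distinct reported sets, and the number `r` of reported sets is at least the number of solutions
of `G[K]`. Hence `T < p(n, r)`. A stage with budget `T ≥ p(n, s)` therefore ends with all
solutions, or with more than `s` solutions, reported. It remains to let the budget grow by one from
stage to stage.

A stage is a structured program for a multi-stack machine in which every loop runs over the contents
of a stack. If these stacks have length at most `B`, then the program compiles to a machine that
needs at most a polynomial in `B` many steps; here `B` is polynomial in `n` and the budget.
-/

open Function Turing

/-! ### Maximal `P` sets of hereditary classes -/

namespace GraphClass

variable {P : GraphClass} {V W : Type} [Finite V] [Finite W]

theorem isSetOf_comap (G : SimpleGraph W) {f : V → W} (hf : Injective f) (U : Set V) :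
    P.IsSetOf (G.comap f) U ↔ P.IsSetOf G (f '' U) := by
  let e : (G.comap f).induce U ≃g G.induce (f '' U) :=
    { toEquiv := Equiv.Set.image f U hf
      map_rel_iff' := Iff.rfl }
  exact ⟨P.iso_closed _ _ ⟨e⟩, P.iso_closed _ _ ⟨e.symm⟩⟩

theorem isSetOf_comap_univ (G : SimpleGraph W) {f : V → W} (hf : Injective f) :
    P.IsSetOf (G.comap f) Set.univ ↔ P.IsSetOf G (Set.range f) := by
  rw [isSetOf_comap G hf, Set.image_univ]

theorem Hereditary.isSetOf_mono (hP : P.Hereditary) {G : SimpleGraph V} {U W : Set V}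
    (hW : P.IsSetOf G W) (hU : U.Nonempty) (hUW : U ⊆ W) : P.IsSetOf G U := by
  have hne : (Subtype.val ⁻¹' U : Set W).Nonempty := hU.elim fun x hx ↦ ⟨⟨x, hUW hx⟩, hx⟩
  have h := (isSetOf_comap G Subtype.val_injective _).1 (hP (G.induce W) _ hne hW)
  rwa [Subtype.image_preimage_coe, Set.inter_eq_right.2 hUW] at h

theorem IsSetOf.exists_isMaximalSetOf {G : SimpleGraph V} {U : Set V} (hU : P.IsSetOf G U) :
    ∃ W, U ⊆ W ∧ P.IsMaximalSetOf G W := by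
  obtain ⟨W, hUW, hW⟩ := Set.Finite.exists_le_maximal (Set.toFinite {W | P.IsSetOf G W}) hU
  exact ⟨W, hUW, hW.1, fun Z hWZ hZ ↦ hWZ.not_subset (hW.2 hZ hWZ.subset)⟩

theorem isMaximalSetOf_univ {G : SimpleGraph V} (h : P.IsSetOf G Set.univ) :
    P.IsMaximalSetOf G Set.univ :=
  ⟨h, fun W hW ↦ absurd (Set.subset_univ W) hW.2⟩

theorem numSolutions_eq_one {G : SimpleGraph V} (h : P.IsSetOf G Set.univ) :
    P.numSolutions G = 1 := by
  refine Set.ncard_eq_one.2 ⟨Set.univ, Set.eq_singleton_iff_unique_mem.2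
    ⟨isMaximalSetOf_univ h, fun U hU ↦ ?_⟩⟩
  by_contra hne
  exact hU.2 _ ((Set.subset_univ U).ssubset_of_ne hne) h

/-- Every `P` set of `G` inside `A` lies in a member of `𝒵`. If the members of `𝒵` are `P` sets,
this says that `𝒵` is a complete list of solutions as far as the vertices in `A` are concerned. -/
def Covers (P : GraphClass) (G : SimpleGraph V) (𝒵 : Set (Set V)) (A : Set V) : Prop :=
  ∀ U ⊆ A, P.IsSetOf G U → ∃ Z ∈ 𝒵, U ⊆ Z

theorem Covers.mono {G : SimpleGraph V} {𝒵 𝒵' : Set (Set V)} {A A' : Set V}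
    (h : P.Covers G 𝒵 A) (h𝒵 : 𝒵 ⊆ 𝒵') (hA : A' ⊆ A) : P.Covers G 𝒵' A' := fun U hU hPU ↦
  (h U (hU.trans hA) hPU).imp fun _ hZ ↦ ⟨h𝒵 hZ.1, hZ.2⟩

theorem covers_range {G : SimpleGraph W} {f : V → W} (hf : Injective f) {𝒵 : Set (Set W)}
    (h : ∀ U, P.IsMaximalSetOf (G.comap f) U → ∃ Z ∈ 𝒵, f '' U ⊆ Z) :
    P.Covers G 𝒵 (Set.range f) := by
  intro X hX hPX
  obtain ⟨X, rfl⟩ := Set.subset_range_iff_exists_image_eq.1 hX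
  obtain ⟨U, hXU, hU⟩ := ((isSetOf_comap G hf X).2 hPX).exists_isMaximalSetOf
  obtain ⟨Z, hZ, hUZ⟩ := h U hU
  exact ⟨Z, hZ, (Set.image_mono hXU).trans hUZ⟩

theorem IsMaximalSetOf.eq_of_subset {G : SimpleGraph V} {U Z : Set V} (hU : P.IsMaximalSetOf G U)
    (hUZ : U ⊆ Z) (hZ : P.IsSetOf G Z) : U = Z := by
  by_contra hne
  exact hU.2 Z (hUZ.ssubset_of_ne hne) hZ

theorem Covers.mem_of_isMaximalSetOf {G : SimpleGraph V} {𝒵 : Set (Set V)} {Z : Set V}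
    (h : P.Covers G 𝒵 Set.univ) (h𝒵 : ∀ Z ∈ 𝒵, P.IsSetOf G Z) (hZ : P.IsMaximalSetOf G Z) :
    Z ∈ 𝒵 := by
  obtain ⟨Y, hY, hZY⟩ := h Z (Set.subset_univ Z) hZ.1
  exact hZ.eq_of_subset hZY (h𝒵 Y hY) ▸ hY

/-- A solution of `G[K]` is a proper subset of `K`, so it lies in some `K \ {v}` and is the trace
on `K` of a member of `𝒵`. -/
theorem Hereditary.numSolutions_comap_le (hP : P.Hereditary) {G : SimpleGraph W} {f : V → W}
    (hf : Injective f) {𝒵 : Set (Set W)} (h𝒵 : ∀ Z ∈ 𝒵, P.IsSetOf G Z)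
    (hK : ¬ P.IsSetOf G (Set.range f)) (h : ∀ v, P.Covers G 𝒵 (Set.range f \ {f v})) :
    P.numSolutions (G.comap f) ≤ 𝒵.ncard := by
  suffices hsub : {U | P.IsMaximalSetOf (G.comap f) U} ⊆ (f ⁻¹' ·) '' 𝒵 from
    (Set.ncard_le_ncard hsub (Set.toFinite _)).trans (Set.ncard_image_le (Set.toFinite _))
  intro U hU
  have hne : U ≠ Set.univ := by
    rintro rfl
    exact hK ((isSetOf_comap_univ G hf).1 hU.1)
  obtain ⟨v, hv⟩ := (Set.ne_univ_iff_exists_notMem U).1 hne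
  have hUv : f '' U ⊆ Set.range f \ {f v} :=
    Set.subset_sdiff_singleton (Set.image_subset_range f U) (hf.mem_set_image.not.2 hv)
  obtain ⟨Z, hZ, hUZ⟩ := h v _ hUv ((isSetOf_comap G hf U).1 hU.1)
  have hUZ : U ⊆ f ⁻¹' Z := Set.image_subset_iff.1 hUZ
  rcases (f ⁻¹' Z).eq_empty_or_nonempty with hempty | hnonempty
  · exact ⟨Z, hZ, hempty.trans (Set.subset_eq_empty hUZ hempty).symm⟩
  · have hPZ := hP.isSetOf_mono (h𝒵 Z hZ) (hnonempty.image f) (Set.image_preimage_subset f Z)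
    exact ⟨Z, hZ, (hU.eq_of_subset hUZ ((isSetOf_comap G hf _).2 hPZ)).symm⟩

open Classical in
/-- The greedy extension of `U`: the vertices of the list `l` are added one after another, except
those whose addition leads out of the `P` sets. -/
noncomputable def greedyExtend (P : GraphClass) (G : SimpleGraph V) (l : List V) (U : Set V) :
    Set V :=
  l.foldl (fun U v ↦ if P.IsSetOf G (insert v U) then insert v U else U) U

section greedyExtend

variable {G : SimpleGraph V} {l : List V} {U : Set V}

open Classical in
theorem greedyExtend_cons (v : V) : P.greedyExtend G (v :: l) U =
    P.greedyExtend G l (if P.IsSetOf G (insert v U) then insert v U else U) := rfl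

theorem greedyExtend_concat (v : V) :
    P.greedyExtend G (l ++ [v]) U = P.greedyExtend G [v] (P.greedyExtend G l U) :=
  List.foldl_append

theorem subset_greedyExtend : U ⊆ P.greedyExtend G l U := by
  induction l generalizing U with
  | nil => exact subset_rfl
  | cons v l ih =>
    rw [greedyExtend_cons]
    refine subset_trans ?_ ih
    split_ifs
    · exact Set.subset_insert v U
    · exact subset_rfl

theorem isSetOf_greedyExtend (hU : P.IsSetOf G U) : P.IsSetOf G (P.greedyExtend G l U) := by
  induction l generalizing U with
  | nil => exact hU
  | cons v l ih =>
    rw [greedyExtend_cons]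
    split_ifs with h
    · exact ih h
    · exact ih hU

theorem Hereditary.mem_greedyExtend (hP : P.Hereditary) {v : V} (hv : v ∈ l)
    (h : P.IsSetOf G (insert v (P.greedyExtend G l U))) : v ∈ P.greedyExtend G l U := by
  induction l generalizing U with
  | nil => simp at hv
  | cons w l ih =>
    rw [greedyExtend_cons] at h ⊢
    rcases List.mem_cons.1 hv with rfl | hv
    · refine subset_greedyExtend ?_
      rw [if_pos]
      · exact Set.mem_insert v U
      · refine hP.isSetOf_mono h (Set.insert_nonempty v U) (Set.insert_subset_insert ?_)
        refine subset_trans ?_ subset_greedyExtend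
        split_ifs
        · exact Set.subset_insert v U
        · exact subset_rfl
    · exact ih hv h

theorem Hereditary.isMaximalSetOf_greedyExtend (hP : P.Hereditary) (hU : P.IsSetOf G U)
    (hl : ∀ v, v ∈ l) : P.IsMaximalSetOf G (P.greedyExtend G l U) := by
  refine ⟨isSetOf_greedyExtend hU, fun W hW hPW ↦ ?_⟩
  obtain ⟨v, hvW, hv⟩ := Set.exists_of_ssubset hW
  exact hv (hP.mem_greedyExtend (hl v) (hP.isSetOf_mono hPW (Set.insert_nonempty v _)
    (Set.insert_subset hvW hW.subset)))

end greedyExtend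

/-- `L` is a list of distinct maximal `P` sets of `G`, not necessarily of all of them. -/
structure ListsSolutions (P : GraphClass) (G : SimpleGraph V) (L : List (Set V)) : Prop where
  nodup : L.Nodup
  isMaximalSetOf : ∀ Z ∈ L, P.IsMaximalSetOf G Z

open Classical in
/-- The list `L`, enlarged by the greedy extensions of the sets in `Us` that are not in it. -/
noncomputable def insertExtensions (P : GraphClass) (G : SimpleGraph V) (l : List V)
    (L Us : List (Set V)) : List (Set V) :=
  Us.foldl (fun L U ↦ L.insert (P.greedyExtend G l U)) L

section ListsSolutions

variable {G : SimpleGraph V} {l : List V} {L Us : List (Set V)} {Z : Set V}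

theorem ListsSolutions.length_le (h : P.ListsSolutions G L) : L.length ≤ P.numSolutions G := by
  classical
  rw [← List.toFinset_card_of_nodup h.nodup, ← Set.ncard_coe_finset]
  exact Set.ncard_le_ncard (fun Z hZ ↦ h.isMaximalSetOf Z (by simpa using hZ)) (Set.toFinite _)

theorem ListsSolutions.mem_iff (h : P.ListsSolutions G L)
    (hL : P.Covers G {Z | Z ∈ L} Set.univ) : Z ∈ L ↔ P.IsMaximalSetOf G Z :=
  ⟨h.isMaximalSetOf Z, hL.mem_of_isMaximalSetOf fun Y hY ↦ (h.isMaximalSetOf Y hY).1⟩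

open Classical in
theorem insertExtensions_cons (U : Set V) : P.insertExtensions G l L (U :: Us) =
    P.insertExtensions G l (L.insert (P.greedyExtend G l U)) Us := rfl

theorem subset_insertExtensions : L ⊆ P.insertExtensions G l L Us := by
  induction Us generalizing L with
  | nil => exact List.Subset.refl L
  | cons _ _ ih => exact fun Z hZ ↦ ih (List.mem_insert_of_mem hZ)

theorem exists_subset_of_mem_insertExtensions {U : Set V} (hU : U ∈ Us) :
    ∃ Z ∈ P.insertExtensions G l L Us, U ⊆ Z := by
  induction Us generalizing L with
  | nil => simp at hU
  | cons W Us ih =>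
    rcases List.mem_cons.1 hU with rfl | hU
    · refine ⟨P.greedyExtend G l U, ?_, subset_greedyExtend⟩
      rw [insertExtensions_cons]
      exact subset_insertExtensions List.mem_insert_self
    · exact ih hU

theorem length_insertExtensions_le :
    (P.insertExtensions G l L Us).length ≤ L.length + Us.length := by
  induction Us generalizing L with
  | nil => rfl
  | cons U Us ih =>
    rw [insertExtensions_cons, List.length_cons]
    grind [List.length_insert]

theorem ListsSolutions.insertExtensions (hP : P.Hereditary) (hl : ∀ v, v ∈ l)
    (hL : P.ListsSolutions G L) (hUs : ∀ U ∈ Us, P.IsSetOf G U) :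
    P.ListsSolutions G (P.insertExtensions G l L Us) := by
  induction Us generalizing L with
  | nil => exact hL
  | cons U Us ih =>
    refine ih ⟨hL.nodup.insert, fun Z hZ ↦ ?_⟩ fun W hW ↦ hUs W (List.mem_cons_of_mem U hW)
    rcases List.mem_insert_iff.1 hZ with rfl | hZ
    · exact hP.isMaximalSetOf_greedyExtend (hUs U List.mem_cons_self) hl
    · exact hL.isMaximalSetOf Z hZ

end ListsSolutions

end GraphClass

/-! ### Codes of sets of vertices and of induced subgraphs -/

/-- The concatenation of a list of words, each of which is followed by the separator `none`. -/
def separated {α : Type*} (xs : List (List α)) : List (Option α) :=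
  xs.flatMap fun x ↦ x.map some ++ [none]

section separated

variable {α : Type*} {x : List α} {xs ys : List (List α)}

@[simp]
theorem separated_nil : separated ([] : List (List α)) = [] := rfl

@[simp]
theorem separated_cons : separated (x :: xs) = x.map some ++ none :: separated xs := by
  simp [separated]

@[simp]
theorem separated_append : separated (xs ++ ys) = separated xs ++ separated ys :=
  List.flatMap_append

theorem length_separated {n : ℕ} (h : ∀ x ∈ xs, x.length = n) :
    (separated xs).length = xs.length * (n + 1) := by
  induction xs with
  | nil => simp
  | cons x xs ih =>
    have hx := h x (List.mem_cons_self)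
    have hxs := ih fun y hy ↦ h y (List.mem_cons_of_mem x hy)
    simp only [separated_cons, List.length_append, List.length_map, List.length_cons, hxs, hx]
    ring

end separated

section vertexSetCode

variable {n : ℕ} {U : Set (Fin n)}

theorem vertexSetCode_eq_map_boolIndicator (U : Set (Fin n)) :
    vertexSetCode U = (List.finRange n).map U.boolIndicator := by
  classical
  refine List.map_congr_left fun i _ ↦ ?_
  rw [Bool.eq_iff_iff, decide_eq_true_iff, Set.mem_iff_boolIndicator]

@[simp]
theorem length_vertexSetCode (U : Set (Fin n)) : (vertexSetCode U).length = n := by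
  simp [vertexSetCode_eq_map_boolIndicator]

@[simp]
theorem getElem_vertexSetCode (U : Set (Fin n)) {i : ℕ} (hi : i < (vertexSetCode U).length) :
    (vertexSetCode U)[i] = U.boolIndicator ⟨i, by simpa using hi⟩ := by
  simp [vertexSetCode_eq_map_boolIndicator]

theorem vertexSetCode_injective : Injective (vertexSetCode (n := n)) := by
  intro U W h
  ext i
  rw [vertexSetCode_eq_map_boolIndicator, vertexSetCode_eq_map_boolIndicator] at h
  rw [Set.mem_iff_boolIndicator, Set.mem_iff_boolIndicator,
    List.map_inj_left.1 h i (List.mem_finRange i)]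

theorem all_vertexSetCode : (vertexSetCode U).all id = true ↔ U = Set.univ := by
  simp [vertexSetCode_eq_map_boolIndicator, Set.eq_univ_iff_forall, ← Set.mem_iff_boolIndicator]

theorem vertexSetCode_univ : vertexSetCode (Set.univ : Set (Fin n)) = List.replicate n true :=
  List.eq_replicate_iff.2 ⟨length_vertexSetCode _, List.all_eq_true.1 (all_vertexSetCode.2 rfl)⟩

theorem vertexSetCode_insert (i : Fin n) :
    vertexSetCode (insert i U) = (vertexSetCode U).set i true := by
  refine List.ext_getElem (by simp) fun j hj _ ↦ ?_
  rw [List.getElem_set, Bool.eq_iff_iff, getElem_vertexSetCode, ← Set.mem_iff_boolIndicator]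
  rcases eq_or_ne (i : ℕ) j with rfl | h
  · simp
  · simp [h, ← Set.mem_iff_boolIndicator, Fin.ext_iff, h.symm]

theorem vertexSetCode_sdiff_singleton (i : Fin n) :
    vertexSetCode (U \ {i}) = (vertexSetCode U).set i false := by
  refine List.ext_getElem (by simp) fun j hj _ ↦ ?_
  rw [List.getElem_set, Bool.eq_iff_iff, getElem_vertexSetCode, ← Set.mem_iff_boolIndicator]
  rcases eq_or_ne (i : ℕ) j with rfl | h
  · simp
  · simp [h, ← Set.mem_iff_boolIndicator, Fin.ext_iff, h.symm]

end vertexSetCode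

section inducedGraph

variable {n : ℕ} {G : SimpleGraph (Fin n)} {S : Set (Fin n)}

/-- The elements of a set of vertices in increasing order. -/
noncomputable def vertexList (S : Set (Fin n)) : List (Fin n) :=
  (List.finRange n).filter S.boolIndicator

/-- The increasing enumeration of a set of vertices. It transports sets of vertices of the
renumbered induced subgraph `inducedGraph G S` to sets of vertices of `G`. -/
noncomputable def vertexEnum (S : Set (Fin n)) : Fin (vertexList S).length → Fin n :=
  (vertexList S).get

theorem vertexEnum_injective (S : Set (Fin n)) : Injective (vertexEnum S) :=
  List.nodup_iff_injective_get.1 ((List.nodup_finRange n).filter _)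

@[simp]
theorem range_vertexEnum (S : Set (Fin n)) : Set.range (vertexEnum S) = S := by
  ext v
  simp [vertexEnum, vertexList, ← Set.mem_iff_boolIndicator]

theorem image_vertexEnum_subset (U : Set (Fin (vertexList S).length)) : vertexEnum S '' U ⊆ S :=
  (Set.image_subset_range _ U).trans (range_vertexEnum S).subset

theorem length_vertexList_le (S : Set (Fin n)) : (vertexList S).length ≤ n :=
  (List.length_filter_le _ _).trans List.length_finRange.le

theorem vertexSetCode_eq_map_vertexList (U : Set (Fin (vertexList S).length)) :
    vertexSetCode U = (vertexList S).map (vertexEnum S '' U).boolIndicator := by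
  refine List.ext_getElem (by simp) fun j hj hj' ↦ ?_
  rw [Bool.eq_iff_iff, getElem_vertexSetCode, List.getElem_map, ← Set.mem_iff_boolIndicator,
    ← Set.mem_iff_boolIndicator]
  exact ((vertexEnum_injective S).mem_set_image (a := ⟨j, by simpa using hj⟩)).symm

/-- The subgraph of `G` induced by `S`, with vertices renumbered as an initial segment of `ℕ` so
that it can be coded as an input word. -/
noncomputable def inducedGraph (G : SimpleGraph (Fin n)) (S : Set (Fin n)) :
    SimpleGraph (Fin (vertexList S).length) :=
  G.comap (vertexEnum S)

theorem GraphClass.isSetOf_inducedGraph {P : GraphClass} {U : Set (Fin (vertexList S).length)} :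
    P.IsSetOf (inducedGraph G S) U ↔ P.IsSetOf G (vertexEnum S '' U) :=
  isSetOf_comap G (vertexEnum_injective S) U

theorem GraphClass.isSetOf_inducedGraph_univ {P : GraphClass} :
    P.IsSetOf (inducedGraph G S) Set.univ ↔ P.IsSetOf G S := by
  rw [isSetOf_inducedGraph, Set.image_univ, range_vertexEnum]

open Classical in
/-- The row of the vertex `i` in the adjacency matrix, restricted to the columns in `l`. -/
noncomputable def adjRow (G : SimpleGraph (Fin n)) (l : List (Fin n)) (i : Fin n) : List Bool :=
  l.map fun j ↦ decide (G.Adj i j)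

theorem graphCode_eq_separated (G : SimpleGraph (Fin n)) :
    graphCode G = separated ((List.finRange n).map (adjRow G (List.finRange n))) := by
  rw [separated, List.flatMap_map]
  exact congrArg (List.flatMap · _) (funext fun i ↦ by rw [adjRow, List.map_map]; rfl)

@[simp]
theorem length_graphCode (G : SimpleGraph (Fin n)) : (graphCode G).length = n * (n + 1) := by
  rw [graphCode_eq_separated, length_separated (n := n)] <;> simp [adjRow]

theorem graphCode_inducedGraph (G : SimpleGraph (Fin n)) (S : Set (Fin n)) :
    graphCode (inducedGraph G S) =
      separated ((vertexList S).map (adjRow G (vertexList S))) := by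
  have hl : vertexList S = (List.finRange (vertexList S).length).map (vertexEnum S) :=
    (List.map_get_finRange _).symm
  conv_rhs => rw [hl, List.map_map, ← hl]
  rw [graphCode_eq_separated]
  refine congrArg separated (List.map_congr_left fun i _ ↦ ?_)
  conv_rhs => rw [comp_apply, adjRow, hl, List.map_map]
  rfl

end inducedGraph

/-! ### Runs of enumeration machines -/

namespace EnumMachine

/-- The configurations of `M`. -/
abbrev Config (M : EnumMachine) : Type := TM2.Cfg M.Γ M.Λ M.σ

/-- One step of `M` as a total function: a halting configuration is repeated. -/
def totalStep (M : EnumMachine) (c : M.Config) : M.Config := (TM2.step M.m c).getD c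

/-- The configuration of `M` on the input word `w` after `t` steps, where a halting configuration
is repeated. -/
def configAt (M : EnumMachine) (w : List (Option Bool)) (t : ℕ) : M.Config :=
  M.totalStep^[t] (initList M.toFinTM2 (w.map M.inputAlphabet.symm))

variable {M : EnumMachine} {w : List (Option Bool)} {t u : ℕ}

theorem totalStep_of_halted {c : M.Config} (h : c.l = none) : M.totalStep c = c := by
  obtain ⟨l, v, S⟩ := c
  obtain rfl : l = none := h
  rfl

theorem emitted_of_halted {c : M.Config} (h : c.l = none) : M.emitted c = none := by
  simp only [emitted, h]

theorem configAt_succ (w : List (Option Bool)) (t : ℕ) :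
    M.configAt w (t + 1) = M.totalStep (M.configAt w t) :=
  iterate_succ_apply' ..

theorem configAt_of_halted (h : (M.configAt w t).l = none) (hu : t ≤ u) :
    M.configAt w u = M.configAt w t := by
  induction u, hu using Nat.le_induction with
  | base => rfl
  | succ u _ ih => rw [configAt_succ, ih, totalStep_of_halted h]

theorem cfgAt_succ_of_halted {c : M.Config} (hc : M.cfgAt w t = some c) (h : c.l = none) :
    M.cfgAt w (t + 1) = none := by
  obtain ⟨l, v, S⟩ := c
  obtain rfl : l = none := h
  rw [cfgAt, hc]
  rfl

theorem cfgAt_eq_some_or_halted (w : List (Option Bool)) (t : ℕ) :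
    M.cfgAt w t = some (M.configAt w t) ∨ (M.cfgAt w t = none ∧ M.HaltsWithin w t) := by
  induction t with
  | zero => exact .inl rfl
  | succ t ih =>
    rcases ih with hc | ⟨hc, u, hu, h⟩
    · rcases hl : (M.configAt w t).l with _ | l
      · exact .inr ⟨cfgAt_succ_of_halted hc hl, t, t.le_succ, _, hc, hl⟩
      · refine .inl ?_
        rw [configAt_succ, cfgAt, hc]
        generalize M.configAt w t = c at hl
        obtain ⟨l', v, S⟩ := c
        obtain rfl : l' = some l := hl
        rfl
    · exact .inr ⟨by rw [cfgAt, hc, Option.bind_none], u, hu.trans t.le_succ, h⟩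

theorem haltsWithin_iff : M.HaltsWithin w t ↔ (M.configAt w t).l = none := by
  constructor
  · rintro ⟨u, hu, c, hc, hl⟩
    rcases cfgAt_eq_some_or_halted (M := M) w u with h | ⟨h, _⟩
    · obtain rfl : c = M.configAt w u := Option.some.inj (hc.symm.trans h)
      rw [configAt_of_halted hl hu, hl]
    · exact absurd (hc.symm.trans h) (Option.some_ne_none c)
  · intro hl
    rcases cfgAt_eq_some_or_halted (M := M) w t with h | ⟨-, h⟩
    · exact ⟨t, le_rfl, _, h, hl⟩
    · exact h

theorem HaltsWithin.mono (h : M.HaltsWithin w t) (htu : t ≤ u) : M.HaltsWithin w u :=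
  let ⟨v, hv, hc⟩ := h
  ⟨v, hv.trans htu, hc⟩

theorem cfgAt_bind_emitted (w : List (Option Bool)) (t : ℕ) :
    (M.cfgAt w t).bind M.emitted = M.emitted (M.configAt w t) := by
  rcases cfgAt_eq_some_or_halted (M := M) w t with h | ⟨h, hl⟩
  · rw [h]; rfl
  · rw [h, emitted_of_halted (haltsWithin_iff.1 hl), Option.bind_none]

theorem filterMap_singleton {α β : Type} (f : α → Option β) (a : α) :
    [a].filterMap f = (f a).toList := by
  cases h : f a <;> simp [h]

theorem outputs_zero (w : List (Option Bool)) :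
    M.outputs w 0 = (M.emitted (M.configAt w 0)).toList := by
  simp only [outputs, cfgAt_bind_emitted]
  exact filterMap_singleton ..

theorem outputs_succ (w : List (Option Bool)) (t : ℕ) :
    M.outputs w (t + 1) = M.outputs w t ++ (M.emitted (M.configAt w (t + 1))).toList := by
  simp only [outputs, cfgAt_bind_emitted, List.range_succ (n := t + 1), List.filterMap_append,
    filterMap_singleton]

theorem outputs_prefix (htu : t ≤ u) : M.outputs w t <+: M.outputs w u := by
  induction u, htu using Nat.le_induction with
  | base => exact List.prefix_rfl
  | succ u _ ih => exact ih.trans (outputs_succ w u ▸ List.prefix_append _ _)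

theorem length_outputs_le (w : List (Option Bool)) (t : ℕ) :
    (M.outputs w t).length ≤ t + 1 :=
  (List.length_filterMap_le _ _).trans_eq List.length_range

theorem HaltsWithin.outputs_of_le (h : M.HaltsWithin w t) (htu : t ≤ u) :
    M.outputs w u = M.outputs w t := by
  induction u, htu using Nat.le_induction with
  | base => rfl
  | succ u htu ih =>
    rw [outputs_succ, ih, emitted_of_halted (haltsWithin_iff.1 (h.mono (htu.trans u.le_succ))),
      Option.toList_none, List.append_nil]

theorem HaltsWithin.outputs_eq (ht : M.HaltsWithin w t) (hu : M.HaltsWithin w u) :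
    M.outputs w t = M.outputs w u :=
  (le_total t u).elim (fun h ↦ (ht.outputs_of_le h).symm) hu.outputs_of_le

namespace EnumeratesWithin

variable {P : GraphClass} {m T : ℕ} {H : SimpleGraph (Fin m)}

theorem mem_outputs_iff (hM : M.EnumeratesWithin P H t) (hT : M.HaltsWithin (graphCode H) T)
    {x : List Bool} :
    x ∈ M.outputs (graphCode H) T ↔ ∃ U, P.IsMaximalSetOf H U ∧ vertexSetCode U = x := by
  rw [hT.outputs_eq hM.1, hM.2.2]

theorem exists_isMaximalSetOf (hM : M.EnumeratesWithin P H t) {x : List Bool}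
    (hx : x ∈ M.outputs (graphCode H) T) :
    ∃ U, P.IsMaximalSetOf H U ∧ vertexSetCode U = x :=
  (hM.mem_outputs_iff (hM.1.mono (le_max_left t T))).1
    ((outputs_prefix (le_max_right t T)).subset hx)

theorem exists_outputs_eq_map (hM : M.EnumeratesWithin P H t) (T : ℕ) :
    ∃ Us : List (Set (Fin m)), M.outputs (graphCode H) T = Us.map vertexSetCode ∧
      ∀ U ∈ Us, P.IsMaximalSetOf H U := by
  have hrange : M.outputs (graphCode H) T ∈ Set.range (List.map (vertexSetCode (n := m))) := by
    rw [Set.range_list_map]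
    intro x hx
    obtain ⟨U, -, hU⟩ := hM.exists_isMaximalSetOf hx
    exact ⟨U, hU⟩
  obtain ⟨Us, hUs⟩ := hrange
  refine ⟨Us, hUs.symm, fun U hU ↦ ?_⟩
  obtain ⟨W, hW, hWU⟩ := hM.exists_isMaximalSetOf (hUs ▸ List.mem_map_of_mem hU)
  exact vertexSetCode_injective hWU ▸ hW

/-- A graph belonging to the class has its full vertex set as its only solution, so a run that is
long enough for graphs with one solution decides membership. -/
theorem any_all_outputs (hM : M.EnumeratesWithin P H t)
    (hT : P.IsSetOf H Set.univ → M.HaltsWithin (graphCode H) T) :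
    ((M.outputs (graphCode H) T).any fun x ↦ x.all id) = true ↔ P.IsSetOf H Set.univ := by
  rw [List.any_eq_true]
  constructor
  · rintro ⟨x, hx, hall⟩
    obtain ⟨U, hU, rfl⟩ := hM.exists_isMaximalSetOf hx
    exact all_vertexSetCode.1 hall ▸ hU.1
  · intro h
    exact ⟨_, (hM.mem_outputs_iff (hT h)).2 ⟨_, GraphClass.isMaximalSetOf_univ h, rfl⟩,
      all_vertexSetCode.2 rfl⟩

theorem mono (h : M.EnumeratesWithin P H t) (htu : t ≤ u) : M.EnumeratesWithin P H u :=
  ⟨h.1.mono htu, (h.1.outputs_of_le htu).symm ▸ h.2⟩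

theorem length_outputs (h : M.EnumeratesWithin P H t) :
    (M.outputs (graphCode H) t).length = P.numSolutions H := by
  have himage : (↑(M.outputs (graphCode H) t).toFinset : Set (List Bool)) =
      vertexSetCode '' {U | P.IsMaximalSetOf H U} := by
    ext x
    simp only [List.coe_toFinset, Set.mem_ofPred_eq, Set.mem_image, h.2.2]
  rw [← List.toFinset_card_of_nodup h.2.1, ← Set.ncard_coe_finset, himage,
    Set.ncard_image_of_injective _ vertexSetCode_injective, GraphClass.numSolutions]

end EnumeratesWithin

/-! ### Growth of the stacks -/

/-- The number of push instructions in a statement. -/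
def pushes {K : Type} {Γ : K → Type} {Λ σ : Type} : TM2.Stmt Γ Λ σ → ℕ
  | .push _ _ q => pushes q + 1
  | .peek _ _ q | .pop _ _ q | .load _ q => pushes q
  | .branch _ p q => pushes p + pushes q
  | .goto _ | .halt => 0

theorem length_update_le {K : Type} [DecidableEq K] {Γ : K → Type} {S : ∀ k, List (Γ k)} {b : ℕ}
    (hS : ∀ j, (S j).length ≤ b) {k : K} {l : List (Γ k)} (hl : l.length ≤ b) (j : K) :
    (update S k l j).length ≤ b := by
  rcases eq_or_ne j k with rfl | hj
  · rwa [update_self]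
  · rw [update_of_ne hj]; exact hS j

theorem length_stepAux_le {K : Type} [DecidableEq K] {Γ : K → Type} {Λ σ : Type}
    (q : TM2.Stmt Γ Λ σ) (v : σ) {S : ∀ k, List (Γ k)} {b : ℕ} (hS : ∀ k, (S k).length ≤ b)
    (j : K) : ((TM2.stepAux q v S).stk j).length ≤ b + pushes q := by
  induction q generalizing v S b with
  | push k f q ih =>
    have hS' := length_update_le (k := k) (l := f v :: S k)
      (fun i ↦ (hS i).trans b.le_succ) (Nat.succ_le_succ (hS k))
    exact (ih _ hS').trans_eq (by rw [pushes, Nat.succ_add, Nat.add_succ])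
  | peek _ _ _ ih => exact ih _ hS
  | pop k _ _ ih =>
    exact ih _ (length_update_le hS (List.length_tail.le.trans ((Nat.sub_le _ _).trans (hS k))))
  | load _ _ ih => exact ih _ hS
  | branch f p q ihp ihq =>
    have hp := ihp v hS
    have hq := ihq v hS
    cases h : f v <;> simp only [TM2.stepAux, pushes, h, cond_true, cond_false] <;> omega
  | goto _ => exact hS j
  | halt => exact hS j

/-- A bound for the growth of the stacks of `M` in one step. -/
def growth (M : EnumMachine) : ℕ := ∑ l ∈ M.ΛFin.elems, pushes (M.m l)

theorem length_totalStep_le {b : ℕ} {c : M.Config} (h : ∀ k, (c.stk k).length ≤ b) (k : M.K) :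
    ((M.totalStep c).stk k).length ≤ b + M.growth := by
  obtain ⟨_ | l, v, S⟩ := c
  · exact (h k).trans (Nat.le_add_right _ _)
  · have hl : pushes (M.m l) ≤ M.growth :=
      Finset.single_le_sum (f := fun l ↦ pushes (M.m l)) (fun _ _ ↦ Nat.zero_le _)
        (M.ΛFin.complete l)
    exact (length_stepAux_le (M.m l) v h k).trans (Nat.add_le_add_left hl b)

theorem stk_configAt_zero (w : List (Option Bool)) :
    (M.configAt w 0).stk = update (fun _ ↦ []) M.k₀ (w.map M.inputAlphabet.symm) := by
  funext k
  rcases eq_or_ne k M.k₀ with rfl | hk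
  · simp [configAt, initList]
  · simp [configAt, initList, hk]

theorem length_configAt_le (w : List (Option Bool)) (t : ℕ) (k : M.K) :
    ((M.configAt w t).stk k).length ≤ w.length + t * M.growth := by
  induction t generalizing k with
  | zero =>
    rw [stk_configAt_zero, Nat.zero_mul, Nat.add_zero]
    exact length_update_le (fun _ ↦ Nat.zero_le _) (List.length_map _).le k
  | succ t ih =>
    rw [configAt_succ, Nat.succ_mul, ← Nat.add_assoc]
    exact length_totalStep_le ih k

end EnumMachine

/-! ### Structured programs on stacks -/

/-- Structured programs over a family of stacks with control variables in `σ`. The program `pop k b`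
pops a symbol off `k`, if there is one, and continues with `b` applied to it; `forEach k b` runs
`b c` for every symbol `c` that stack `k` holds on entry. -/
inductive StackProgram {K : Type} (Γ : K → Type) (σ : Type) : Type
  | push (k : K) (f : σ → Γ k) : StackProgram Γ σ
  | load (f : σ → σ) : StackProgram Γ σ
  | emit : StackProgram Γ σ
  | seq (p q : StackProgram Γ σ) : StackProgram Γ σ
  | ite (c : σ → Bool) (p q : StackProgram Γ σ) : StackProgram Γ σ
  | pop (k : K) (b : Option (Γ k) → StackProgram Γ σ) : StackProgram Γ σ
  | forEach (k : K) (b : Γ k → StackProgram Γ σ) : StackProgram Γ σ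

namespace StackProgram

variable {K : Type} {Γ : K → Type} {σ : Type}

/-- The input and output stacks of a program, with the identification of their alphabets. -/
structure Ports (Γ : K → Type) where
  input : K
  output : K
  inputAlphabet : Γ input ≃ Option Bool
  outputAlphabet : Γ output ≃ Bool

/-- The word that is emitted when the stacks are `S`. -/
def Ports.read (io : Ports Γ) (S : ∀ k, List (Γ k)) : List Bool :=
  (S io.output).map io.outputAlphabet

/-- The state of a program: control variables, stacks, and the words emitted so far. -/
@[ext] structure State (Γ : K → Type) (σ : Type) where
  var : σ
  stk : ∀ k, List (Γ k)
  trace : List (List Bool)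

/-- Running through a list, with one transition of `R` per element. -/
def Traverse {α S : Type} (R : α → S → S → Prop) : List α → S → S → Prop
  | [], s, s' => s' = s
  | c :: l, s, s' => ∃ s₁, R c s s₁ ∧ Traverse R l s₁ s'

/-- `p.Runs io B s s'`: the program `p` leads from `s` to `s'`, and all its loops have length at
most `B`. -/
def Runs [DecidableEq K] (io : Ports Γ) (B : ℕ) :
    StackProgram Γ σ → State Γ σ → State Γ σ → Prop
  | push k f, s, s' => s' = { s with stk := update s.stk k (f s.var :: s.stk k) }
  | load f, s, s' => s' = { s with var := f s.var }
  | emit, s, s' => s' = { s with trace := s.trace ++ [io.read s.stk] }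
  | seq p q, s, s' => ∃ s₁, Runs io B p s s₁ ∧ Runs io B q s₁ s'
  | ite c p q, s, s' => bif c s.var then Runs io B p s s' else Runs io B q s s'
  | pop k b, s, s' =>
    Runs io B (b (s.stk k).head?) { s with stk := update s.stk k (s.stk k).tail } s'
  | forEach k b, s, s' => (s.stk k).length ≤ B ∧ Traverse (fun c ↦ Runs io B (b c)) (s.stk k) s s'

/-- A bound for the number of machine steps of a program whose loops have length at most `B`. -/
def cost [∀ k, Fintype (Γ k)] (B : ℕ) : StackProgram Γ σ → ℕ
  | push _ _ | load _ | emit => 1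
  | seq p q => cost B p + cost B q
  | ite _ p q => cost B p + cost B q + 1
  | pop _ b => ∑ o, cost B (b o) + 1
  | forEach _ b => 4 * B + 4 + B * ∑ c, cost B (b c)

/-! ### Compilation of programs -/

/-- The control labels of a compiled loop outside its body. The content of the stack is moved to an
auxiliary stack (`collect`), and moved back with a copy on the stack of pending symbols (`restore`,
`copy`), whose bottom is marked (`mark`) because loops are nested; the body is run once per pending
symbol (`next`). -/
inductive LoopLabel (α : Type) : Type
  | mark | collect | restore | copy (c : α) | next
  deriving Fintype

/-- The control labels of a compiled program. -/
@[reducible] def Label : StackProgram Γ σ → Type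
  | push _ _ | load _ | emit => Unit
  | seq p q => Label p ⊕ Label q
  | ite _ p q => Option (Label p ⊕ Label q)
  | pop k b => Option (Σ o : Option (Γ k), Label (b o))
  | forEach k b => LoopLabel (Γ k) ⊕ Σ c : Γ k, Label (b c)

/-- The first label of a compiled program. -/
def entry : ∀ p : StackProgram Γ σ, Label p
  | push _ _ | load _ | emit => ()
  | seq p _ => .inl (entry p)
  | ite _ _ _ | pop _ _ => none
  | forEach _ _ => .inl .mark

/-- The output labels of a compiled program. -/
def isEmit : ∀ p : StackProgram Γ σ, Label p → Bool
  | push _ _, _ | load _, _ => false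
  | emit, _ => true
  | seq p _, .inl a => isEmit p a
  | seq _ q, .inr a => isEmit q a
  | ite _ _ _, none | pop _ _, none => false
  | ite _ p _, some (.inl a) => isEmit p a
  | ite _ _ q, some (.inr a) => isEmit q a
  | pop _ b, some ⟨o, a⟩ => isEmit (b o) a
  | forEach _ _, .inl _ => false
  | forEach _ b, .inr ⟨c, a⟩ => isEmit (b c) a

theorem finite_label [∀ k, Finite (Γ k)] (p : StackProgram Γ σ) : Finite (Label p) := by
  induction p with
  | push | load | emit => exact inferInstanceAs (Finite Unit)
  | seq p q | ite c p q => infer_instance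
  | pop k b => infer_instance
  | forEach k b =>
    have := Fintype.ofFinite (Γ k)
    infer_instance

/-- A register of a compiled program, holding at most one stack symbol. -/
abbrev Register (Γ : K → Type) : Type := Option (Σ k, Γ k)

/-- The content of a register as a symbol of stack `k`. -/
def Register.get [DecidableEq K] (k : K) : Register Γ → Option (Γ k)
  | none => none
  | some ⟨k', c⟩ => if h : k' = k then some (h ▸ c) else none

@[simp] theorem Register.get_map [DecidableEq K] (k : K) (o : Option (Γ k)) :
    Register.get k (o.map (Sigma.mk k)) = o := by
  cases o <;> simp [Register.get]

/-- The stack alphabets of a compiled program. There are two auxiliary stacks: `.inr false` holds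
the symbols that a loop has collected, and `.inr true` the pending symbols of all loops. -/
@[reducible] def CompiledAlphabet (Γ : K → Type) : K ⊕ Bool → Type
  | .inl k => Γ k
  | .inr _ => Register Γ

/-- The stacks of a compiled program. -/
def compiledStacks (S : ∀ k, List (Γ k)) (collected pending : List (Register Γ)) :
    ∀ k, List (CompiledAlphabet Γ k)
  | .inl k => S k
  | .inr false => collected
  | .inr true => pending

section

variable [DecidableEq K] (S : ∀ k, List (Γ k)) (collected pending x : List (Register Γ))

theorem update_compiledStacks_inl (k : K) (x : List (Γ k)) :
    update (compiledStacks S collected pending) (.inl k) x =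
      compiledStacks (update S k x) collected pending := by
  funext j
  rcases j with j | (_ | _)
  · rcases eq_or_ne j k with rfl | hj
    · simp [compiledStacks]
    · rw [update_of_ne (by simpa using hj)]
      simp [compiledStacks, update_of_ne hj]
  all_goals simp [compiledStacks]

theorem update_compiledStacks_collected :
    update (compiledStacks S collected pending) (.inr false) x = compiledStacks S x pending := by
  funext j
  rcases j with j | (_ | _) <;> simp [compiledStacks]

theorem update_compiledStacks_pending :
    update (compiledStacks S collected pending) (.inr true) x = compiledStacks S collected x := by
  funext j
  rcases j with j | (_ | _) <;> simp [compiledStacks]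

/-- The code of a compiled program whose labels are embedded by `e` and which continues at `nx`. -/
def compile {Λ : Type} : ∀ p : StackProgram Γ σ, (Label p → Λ) → Λ → Label p →
    TM2.Stmt (CompiledAlphabet Γ) Λ (σ × Register Γ)
  | push k f, _, nx, _ => .push (.inl k) (fun v ↦ f v.1) (.goto fun _ ↦ nx)
  | load f, _, nx, _ => .load (fun v ↦ (f v.1, v.2)) (.goto fun _ ↦ nx)
  | emit, _, nx, _ => .goto fun _ ↦ nx
  | seq p q, e, _, .inl a => compile p (fun a ↦ e (.inl a)) (e (.inr (entry q))) a
  | seq _ q, e, nx, .inr a => compile q (fun a ↦ e (.inr a)) nx a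
  | ite c p q, e, _, none => .goto fun v ↦
      bif c v.1 then e (some (.inl (entry p))) else e (some (.inr (entry q)))
  | ite _ p _, e, nx, some (.inl a) => compile p (fun a ↦ e (some (.inl a))) nx a
  | ite _ _ q, e, nx, some (.inr a) => compile q (fun a ↦ e (some (.inr a))) nx a
  | pop k _, e, _, none => .pop (.inl k) (fun v o ↦ (v.1, o.map (Sigma.mk k)))
      (.goto fun v ↦ e (some ⟨v.2.get k, entry _⟩))
  | pop _ b, e, nx, some ⟨o, a⟩ => compile (b o) (fun a ↦ e (some ⟨o, a⟩)) nx a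
  | forEach _ _, e, _, .inl .mark =>
      .push (.inr true) (fun _ ↦ (none : Register Γ)) (.goto fun _ ↦ e (.inl .collect))
  | forEach k _, e, _, .inl .collect =>
      .pop (.inl k) (fun v o ↦ (v.1, o.map (Sigma.mk k))) <|
        .branch (fun v ↦ v.2.isSome)
          (.push (.inr false) (fun v ↦ v.2) (.goto fun _ ↦ e (.inl .collect)))
          (.goto fun _ ↦ e (.inl .restore))
  | forEach k _, e, _, .inl .restore =>
      .pop (.inr false) (fun v o ↦ (v.1, o.join)) <|
        .goto fun v ↦ (v.2.get k).elim (e (.inl .next)) fun c ↦ e (.inl (.copy c))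
  | forEach k _, e, _, .inl (.copy c) =>
      .push (.inl k) (fun _ ↦ c) <| .push (.inr true) (fun _ ↦ some ⟨k, c⟩) <|
        .goto fun _ ↦ e (.inl .restore)
  | forEach k _, e, nx, .inl .next =>
      .pop (.inr true) (fun v o ↦ (v.1, o.join)) <|
        .goto fun v ↦ (v.2.get k).elim nx fun c ↦ e (.inr ⟨c, entry _⟩)
  | forEach _ b, e, _, .inr ⟨c, a⟩ =>
      compile (b c) (fun a ↦ e (.inr ⟨c, a⟩)) (e (.inl .next)) a

end

end StackProgram

namespace StackProgram.Traverse

variable {α S S' : Type} {R : α → S → S → Prop} {l l₁ l₂ : List α} {c : α} {s s₁ s' : S}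

theorem of_eq (h₁ : Traverse R l s s₁) (h₂ : s₁ = s') : Traverse R l s s' := h₂ ▸ h₁

theorem cons (h₁ : R c s s₁) (h₂ : Traverse R l s₁ s') : Traverse R (c :: l) s s' := ⟨s₁, h₁, h₂⟩

theorem append (h₁ : Traverse R l₁ s s₁) (h₂ : Traverse R l₂ s₁ s') :
    Traverse R (l₁ ++ l₂) s s' := by
  induction l₁ generalizing s with
  | nil => obtain rfl : s₁ = s := h₁; exact h₂
  | cons c l₁ ih => obtain ⟨s₂, hc, h₁⟩ := h₁; exact .cons hc (ih h₁)

theorem map {R' : α → S' → S' → Prop} {f : S → S'} (hR : ∀ c s s', R c s s' → R' c (f s) (f s'))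
    (h : Traverse R l s s') : Traverse R' l (f s) (f s') := by
  induction l generalizing s with
  | nil => exact congrArg f h
  | cons c l ih => obtain ⟨s₁, hc, h⟩ := h; exact .cons (hR _ _ _ hc) (ih h)

theorem of_forall_getElem {I : ℕ → S} (h : ∀ i (hi : i < l.length), R l[i] (I i) (I (i + 1))) :
    Traverse R l (I 0) (I l.length) := by
  induction l generalizing I with
  | nil => rfl
  | cons c l ih =>
    exact .cons (h 0 (by simp))
      (ih (I := fun i ↦ I (i + 1)) fun i hi ↦ h (i + 1) (by simpa using hi))

theorem exists_of_forall_getElem {I : ℕ → S → Prop} (h₀ : I 0 s)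
    (h : ∀ i (hi : i < l.length) s, I i s → ∃ s', R l[i] s s' ∧ I (i + 1) s') :
    ∃ s', Traverse R l s s' ∧ I l.length s' := by
  induction l generalizing s I with
  | nil => exact ⟨s, rfl, h₀⟩
  | cons c l ih =>
    obtain ⟨s₁, hc, h₁⟩ := h 0 (by simp) s h₀
    obtain ⟨s', h', hs'⟩ := ih (I := fun i ↦ I (i + 1)) h₁ fun i hi ↦ h (i + 1) (by simpa using hi)
    exact ⟨s', .cons hc h', hs'⟩

end StackProgram.Traverse

/-! ### Correctness of the compilation -/

/-- `ReachesWithin f T a b`: iterating the partial function `f` leads from `a` to `b` in at most `T`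
steps. -/
inductive ReachesWithin {α : Type} (f : α → Option α) : ℕ → α → α → Prop
  | refl (T : ℕ) (a : α) : ReachesWithin f T a a
  | head {T : ℕ} {a b c : α} (hab : f a = some b) (hbc : ReachesWithin f T b c) :
      ReachesWithin f (T + 1) a c

namespace ReachesWithin

variable {α : Type} {f : α → Option α} {T U : ℕ} {a b c : α}

theorem mono (h : ReachesWithin f T a b) (hTU : T ≤ U) : ReachesWithin f U a b := by
  induction h generalizing U with
  | refl => exact .refl U _
  | head hab _ ih =>
    obtain ⟨U, rfl⟩ := Nat.exists_eq_add_of_le' (Nat.succ_le_iff.2 (Nat.zero_lt_of_lt hTU))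
    exact .head hab (ih (Nat.le_of_succ_le_succ hTU))

theorem trans (hab : ReachesWithin f T a b) (hbc : ReachesWithin f U b c) :
    ReachesWithin f (T + U) a c := by
  induction hab with
  | refl T => exact hbc.mono (Nat.le_add_left U T)
  | head h _ ih => rw [Nat.add_right_comm]; exact .head h (ih hbc)

end ReachesWithin

namespace StackProgram

/-- A step of a machine, together with the words it has emitted; a word is emitted on leaving an
output label. -/
def tracedStep {K : Type} [DecidableEq K] {Γ : K → Type} {Λ σ : Type} (m : Λ → TM2.Stmt Γ Λ σ)
    (em : Λ → Bool) (read : (∀ k, List (Γ k)) → List Bool) :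
    TM2.Cfg Γ Λ σ × List (List Bool) → Option (TM2.Cfg Γ Λ σ × List (List Bool))
  | (⟨none, _, _⟩, _) => none
  | (⟨some l, v, S⟩, o) => some (TM2.stepAux (m l) v S, if em l then o ++ [read S] else o)

section

variable {K : Type} [DecidableEq K] {Γ : K → Type} {σ Λ : Type}
  {m : Λ → TM2.Stmt (CompiledAlphabet Γ) Λ (σ × Register Γ)} {em : Λ → Bool} {io : Ports Γ}

/-- The configuration of a compiled program in the state `s`, with the words emitted so far. -/
def compiledCfg (l : Λ) (s : State Γ σ) (r : Register Γ) (collected pending : List (Register Γ)) :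
    TM2.Cfg (CompiledAlphabet Γ) Λ (σ × Register Γ) × List (List Bool) :=
  (⟨some l, (s.var, r), compiledStacks s.stk collected pending⟩, s.trace)

/-- Steps of a machine with code `m` and output labels `em` that runs compiled programs. -/
def compiledStep (m : Λ → TM2.Stmt (CompiledAlphabet Γ) Λ (σ × Register Γ)) (em : Λ → Bool)
    (io : Ports Γ) := tracedStep m em fun S ↦ io.read fun k ↦ S (.inl k)

/-- The code `m` contains the compiled program `p`, with labels embedded by `e` and continuing
at `nx`. -/
structure Implements (m : Λ → TM2.Stmt (CompiledAlphabet Γ) Λ (σ × Register Γ)) (em : Λ → Bool)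
    (p : StackProgram Γ σ) (e : Label p → Λ) (nx : Λ) : Prop where
  code_eq : ∀ a, m (e a) = compile p e nx a
  emit_eq : ∀ a, em (e a) = isEmit p a

/-- Wherever it is placed, the compiled program `p` does what `p` does, within `cost B p` steps. -/
def Simulated [∀ k, Fintype (Γ k)] (io : Ports Γ) (B : ℕ) (p : StackProgram Γ σ) : Prop :=
  ∀ {Λ : Type} {m : Λ → TM2.Stmt (CompiledAlphabet Γ) Λ (σ × Register Γ)} {em : Λ → Bool}
    {e : Label p → Λ} {nx : Λ}, Implements m em p e nx → ∀ {s s' : State Γ σ}, p.Runs io B s s' →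
    ∀ (r : Register Γ) (h : List (Register Γ)), ∃ r', ReachesWithin (compiledStep m em io)
      (cost B p) (compiledCfg (e (entry p)) s r [] h) (compiledCfg nx s' r' [] h)

theorem Implements.step {p : StackProgram Γ σ} {e : Label p → Λ} {nx : Λ}
    (hp : Implements m em p e nx) {a : Label p} (ha : isEmit p a = false) (s : State Γ σ)
    (r : Register Γ) (t h : List (Register Γ)) :
    compiledStep m em io (compiledCfg (e a) s r t h) =
      some (TM2.stepAux (compile p e nx a) (s.var, r) (compiledStacks s.stk t h), s.trace) := by
  simp only [compiledStep, compiledCfg, tracedStep, hp.code_eq, hp.emit_eq, ha, Bool.false_eq_true,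
    if_false]

section Loop

variable {k : K} {b : Γ k → StackProgram Γ σ} {e : Label (.forEach k b) → Λ} {nx : Λ}
  (hp : Implements m em (.forEach k b) e nx) (s : State Γ σ) (r : Register Γ)
  (t h : List (Register Γ))

include hp

theorem Implements.step_mark :
    compiledStep m em io (compiledCfg (e (.inl .mark)) s r t h) =
      some (compiledCfg (e (.inl .collect)) s r t (none :: h)) := by
  rw [hp.step rfl]
  simp [compile, TM2.stepAux, update_compiledStacks_pending, compiledStacks, compiledCfg]

theorem Implements.step_collect_nil (hs : s.stk k = []) :
    compiledStep m em io (compiledCfg (e (.inl .collect)) s r t h) =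
      some (compiledCfg (e (.inl .restore)) { s with stk := update s.stk k [] } none t h) := by
  rw [hp.step rfl]
  simp [compile, TM2.stepAux, update_compiledStacks_inl, compiledStacks, compiledCfg, hs]

theorem Implements.step_collect_cons {c : Γ k} {l : List (Γ k)} (hs : s.stk k = c :: l) :
    compiledStep m em io (compiledCfg (e (.inl .collect)) s r t h) =
      some (compiledCfg (e (.inl .collect)) { s with stk := update s.stk k l } (some ⟨k, c⟩)
        (some ⟨k, c⟩ :: t) h) := by
  rw [hp.step rfl]
  simp [compile, TM2.stepAux, update_compiledStacks_inl, update_compiledStacks_collected,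
    compiledStacks, compiledCfg, hs]

theorem Implements.step_restore_nil :
    compiledStep m em io (compiledCfg (e (.inl .restore)) s r [] h) =
      some (compiledCfg (e (.inl .next)) s none [] h) := by
  rw [hp.step rfl]
  simp [compile, TM2.stepAux, update_compiledStacks_collected, compiledStacks, compiledCfg,
    Register.get]

theorem Implements.step_restore_cons (c : Γ k) :
    compiledStep m em io (compiledCfg (e (.inl .restore)) s r (some ⟨k, c⟩ :: t) h) =
      some (compiledCfg (e (.inl (.copy c))) s (some ⟨k, c⟩) t h) := by
  rw [hp.step rfl]
  simp [compile, TM2.stepAux, update_compiledStacks_collected, compiledStacks, compiledCfg,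
    Register.get]

theorem Implements.step_copy (c : Γ k) :
    compiledStep m em io (compiledCfg (e (.inl (.copy c))) s r t h) =
      some (compiledCfg (e (.inl .restore)) { s with stk := update s.stk k (c :: s.stk k) } r t
        (some ⟨k, c⟩ :: h)) := by
  rw [hp.step rfl]
  simp [compile, TM2.stepAux, update_compiledStacks_inl, update_compiledStacks_pending,
    compiledStacks, compiledCfg]

theorem Implements.step_next_none :
    compiledStep m em io (compiledCfg (e (.inl .next)) s r t (none :: h)) =
      some (compiledCfg nx s none t h) := by
  rw [hp.step rfl]
  simp [compile, TM2.stepAux, update_compiledStacks_pending, compiledStacks, compiledCfg,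
    Register.get]

theorem Implements.step_next_some (c : Γ k) :
    compiledStep m em io (compiledCfg (e (.inl .next)) s r t (some ⟨k, c⟩ :: h)) =
      some (compiledCfg (e (.inr ⟨c, entry (b c)⟩)) s (some ⟨k, c⟩) t h) := by
  rw [hp.step rfl]
  simp [compile, TM2.stepAux, update_compiledStacks_pending, compiledStacks, compiledCfg,
    Register.get]

/-- The symbols of a list as register contents. -/
def registers {k : K} (l : List (Γ k)) : List (Register Γ) := l.map fun c ↦ some ⟨k, c⟩

theorem Implements.reachesWithin_collect (l : List (Γ k)) (hs : s.stk k = l) :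
    ∃ r', ReachesWithin (compiledStep m em io) (l.length + 1)
      (compiledCfg (e (.inl .collect)) s r t h)
      (compiledCfg (e (.inl .restore)) { s with stk := update s.stk k [] } r'
        (registers l.reverse ++ t) h) := by
  induction l generalizing s r t with
  | nil => exact ⟨none, .head (hp.step_collect_nil s r t h hs) (.refl 0 _)⟩
  | cons c l ih =>
    obtain ⟨r', h'⟩ := ih { s with stk := update s.stk k l } (some ⟨k, c⟩) (some ⟨k, c⟩ :: t)
      (update_self ..)
    refine ⟨r', .head (hp.step_collect_cons s r t h hs) ?_⟩
    simpa [registers] using h'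

theorem Implements.reachesWithin_restore (l : List (Γ k)) :
    ∃ r', ReachesWithin (compiledStep m em io) (2 * l.length + 1)
      (compiledCfg (e (.inl .restore)) s r (registers l) h)
      (compiledCfg (e (.inl .next)) { s with stk := update s.stk k (l.reverse ++ s.stk k) } r' []
        (registers l.reverse ++ h)) := by
  induction l generalizing s r h with
  | nil =>
    refine ⟨none, .head (hp.step_restore_nil s r h) ?_⟩
    simpa [registers] using .refl 0 _
  | cons c l ih =>
    obtain ⟨r', h'⟩ := ih { s with stk := update s.stk k (c :: s.stk k) } (some ⟨k, c⟩)
      (some ⟨k, c⟩ :: h)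
    refine ⟨r', .head (hp.step_restore_cons s r _ h c) (.head (hp.step_copy s _ _ h c) ?_)⟩
    simpa [registers] using h'

theorem Implements.reachesWithin_next [∀ k, Fintype (Γ k)] {B : ℕ}
    (hb : ∀ c, Simulated io B (b c)) {s' : State Γ σ} (l : List (Γ k))
    (hl : Traverse (fun c ↦ Runs io B (b c)) l s s') :
    ∃ r', ReachesWithin (compiledStep m em io) (1 + l.length + l.length * ∑ c, cost B (b c))
      (compiledCfg (e (.inl .next)) s r [] (registers l ++ none :: h))
      (compiledCfg nx s' r' [] h) := by
  induction l generalizing s r with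
  | nil =>
    obtain rfl : s' = s := hl
    exact ⟨none, (ReachesWithin.head (hp.step_next_none s' r [] h) (.refl 0 _)).mono (by simp)⟩
  | cons c l ih =>
    obtain ⟨s₁, hc, hl⟩ := hl
    have hbody : Implements m em (b c) (fun a ↦ e (.inr ⟨c, a⟩)) (e (.inl .next)) :=
      ⟨fun _ ↦ hp.code_eq _, fun _ ↦ hp.emit_eq _⟩
    obtain ⟨r₁, h₁⟩ := hb c hbody hc (some ⟨k, c⟩) (registers l ++ none :: h)
    obtain ⟨r₂, h₂⟩ := ih s₁ r₁ hl
    refine ⟨r₂, (ReachesWithin.head (hp.step_next_some s r [] _ c) (h₁.trans h₂)).mono ?_⟩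
    have hle : cost B (b c) ≤ ∑ c, cost B (b c) :=
      Finset.single_le_sum (f := fun c ↦ cost B (b c)) (fun _ _ ↦ Nat.zero_le _)
        (Finset.mem_univ c)
    rw [List.length_cons, Nat.succ_mul]
    omega

end Loop

variable [∀ k, Fintype (Γ k)] {B : ℕ} {p q : StackProgram Γ σ}

theorem simulated_push (k : K) (f : σ → Γ k) : Simulated io B (push k f : StackProgram Γ σ) := by
  rintro Λ m em e nx hp s _ rfl r h
  refine ⟨r, .head (hp.step rfl s r [] h) ?_⟩
  simpa [compile, TM2.stepAux, update_compiledStacks_inl, compiledStacks] using .refl 0 _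

theorem simulated_load (f : σ → σ) : Simulated io B (load f : StackProgram Γ σ) := by
  rintro Λ m em e nx hp s _ rfl r h
  exact ⟨r, .head (hp.step rfl s r [] h) (.refl 0 _)⟩

theorem simulated_emit : Simulated io B (emit : StackProgram Γ σ) := by
  rintro Λ m em e nx hp s _ rfl r h
  refine ⟨r, .head ?_ (.refl 0 _)⟩
  simp [compiledStep, compiledCfg, tracedStep, hp.code_eq, hp.emit_eq, isEmit, compile,
    TM2.stepAux, compiledStacks]

theorem Simulated.seq (hp : Simulated io B p) (hq : Simulated io B q) :
    Simulated io B (.seq p q) := by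
  rintro Λ m em e nx h s s' ⟨s₁, hs, hs'⟩ r t
  have hl : Implements m em p (fun a ↦ e (.inl a)) (e (.inr (entry q))) :=
    ⟨fun _ ↦ h.code_eq _, fun _ ↦ h.emit_eq _⟩
  have hr : Implements m em q (fun a ↦ e (.inr a)) nx :=
    ⟨fun _ ↦ h.code_eq _, fun _ ↦ h.emit_eq _⟩
  obtain ⟨r₁, h₁⟩ := hp hl hs r t
  obtain ⟨r₂, h₂⟩ := hq hr hs' r₁ t
  exact ⟨r₂, h₁.trans h₂⟩

theorem Simulated.ite (hp : Simulated io B p) (hq : Simulated io B q) (c : σ → Bool) :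
    Simulated io B (.ite c p q) := by
  intro Λ m em e nx h s s' hs r t
  have hl : Implements m em p (fun a ↦ e (some (.inl a))) nx :=
    ⟨fun _ ↦ h.code_eq _, fun _ ↦ h.emit_eq _⟩
  have hr : Implements m em q (fun a ↦ e (some (.inr a))) nx :=
    ⟨fun _ ↦ h.code_eq _, fun _ ↦ h.emit_eq _⟩
  have hstep := h.step (io := io) (a := none) rfl s r [] t
  rcases hc : c s.var
  · rw [Runs, hc, cond_false] at hs
    obtain ⟨r₁, h₁⟩ := hq hr hs r t
    simp only [compile, TM2.stepAux, hc, cond_false] at hstep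
    exact ⟨r₁, (ReachesWithin.head hstep h₁).mono (Nat.succ_le_succ (Nat.le_add_left _ _))⟩
  · rw [Runs, hc, cond_true] at hs
    obtain ⟨r₁, h₁⟩ := hp hl hs r t
    simp only [compile, TM2.stepAux, hc, cond_true] at hstep
    exact ⟨r₁, (ReachesWithin.head hstep h₁).mono (Nat.succ_le_succ (Nat.le_add_right _ _))⟩

theorem simulated_pop {k : K} {b : Option (Γ k) → StackProgram Γ σ}
    (hb : ∀ o, Simulated io B (b o)) : Simulated io B (.pop k b) := by
  intro Λ m em e nx h s s' hs r t
  have hbody : Implements m em (b (s.stk k).head?) (fun a ↦ e (some ⟨_, a⟩)) nx :=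
    ⟨fun _ ↦ h.code_eq _, fun _ ↦ h.emit_eq _⟩
  have hstep := h.step (io := io) (a := none) rfl s r [] t
  simp only [compile, TM2.stepAux, update_compiledStacks_inl, compiledStacks] at hstep
  rw [Register.get_map] at hstep
  obtain ⟨r₁, h₁⟩ := hb _ hbody hs ((s.stk k).head?.map (Sigma.mk k)) t
  have hle : cost B (b (s.stk k).head?) ≤ ∑ o, cost B (b o) :=
    Finset.single_le_sum (f := fun o ↦ cost B (b o)) (fun _ _ ↦ Nat.zero_le _)
      (Finset.mem_univ _)
  exact ⟨r₁, (ReachesWithin.head hstep h₁).mono (Nat.succ_le_succ hle)⟩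

theorem simulated_forEach {k : K} {b : Γ k → StackProgram Γ σ}
    (hb : ∀ c, Simulated io B (b c)) : Simulated io B (.forEach k b) := by
  rintro Λ m em e nx hp s s' ⟨hB, hs⟩ r h
  obtain ⟨r₁, h₁⟩ := hp.reachesWithin_collect (io := io) s r [] (none :: h) _ rfl
  obtain ⟨r₂, h₂⟩ := hp.reachesWithin_restore (io := io) { s with stk := update s.stk k [] } r₁
    (none :: h) (s.stk k).reverse
  obtain ⟨r₃, h₃⟩ := hp.reachesWithin_next s r₂ h hb _ hs
  rw [List.append_nil] at h₁
  simp only [List.reverse_reverse, update_self, List.append_nil, update_idem, update_eq_self,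
    List.length_reverse] at h₂
  refine ⟨r₃, (ReachesWithin.head (hp.step_mark s r [] h) ((h₁.trans h₂).trans h₃)).mono ?_⟩
  have hmul := Nat.mul_le_mul_right (∑ c, cost B (b c)) hB
  rw [cost]
  omega

theorem simulated (io : Ports Γ) (B : ℕ) (p : StackProgram Γ σ) : Simulated io B p := by
  induction p with
  | push k f => exact simulated_push k f
  | load f => exact simulated_load f
  | emit => exact simulated_emit
  | seq p q hp hq => exact hp.seq hq
  | ite c p q hp hq => exact hp.ite hq c
  | pop k b hb => exact simulated_pop hb
  | forEach k b hb => exact simulated_forEach hb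

end

end StackProgram

/-! ### Machines of looping programs -/

theorem EnumMachine.exists_outputs_of_reachesWithin {M : EnumMachine} {w : List (Option Bool)}
    {T : ℕ} {c c' : M.Config × List (List Bool)}
    (h : ReachesWithin (StackProgram.tracedStep M.m M.emit
      fun S ↦ (S M.k₁).map M.outputAlphabet) T c c') {u : ℕ}
    (hu : M.configAt w u = c.1) (ho : M.outputs w u = c.2 ++ (M.emitted c.1).toList) :
    ∃ u' ≤ u + T, M.configAt w u' = c'.1 ∧ M.outputs w u' = c'.2 ++ (M.emitted c'.1).toList := by
  induction h generalizing u with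
  | refl T c => exact ⟨u, Nat.le_add_right u T, hu, ho⟩
  | @head T c c₁ c' hstep _ ih =>
    have hc₁ : M.configAt w (u + 1) = c₁.1 ∧ M.outputs w u = c₁.2 := by
      rw [M.configAt_succ, hu, ho]
      obtain ⟨⟨_ | l, v, S⟩, o⟩ := c <;> simp only [StackProgram.tracedStep] at hstep
      · contradiction
      · obtain rfl := Option.some.inj hstep
        refine ⟨rfl, ?_⟩
        simp only [emitted]
        split_ifs <;> simp
    obtain ⟨u', hu', h'⟩ := ih hc₁.1 (by rw [M.outputs_succ, hc₁.1, hc₁.2])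
    exact ⟨u', by omega, h'⟩

/-- A program that runs `init` and then repeats `body` until `done` holds. -/
structure LoopProgram {K : Type} (Γ : K → Type) (σ : Type) extends StackProgram.Ports Γ where
  initial : σ
  init : StackProgram Γ σ
  body : StackProgram Γ σ
  done : σ → Bool

namespace LoopProgram

open StackProgram

variable {K : Type} {Γ : K → Type} {σ : Type}

/-- The code of a looping program; the label `.inr (.inr ())` is the head of the loop. -/
def code [DecidableEq K] (A : LoopProgram Γ σ) : Label A.init ⊕ Label A.body ⊕ Unit →
    TM2.Stmt (CompiledAlphabet Γ) (Label A.init ⊕ Label A.body ⊕ Unit) (σ × Register Γ)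
  | .inl a => compile A.init .inl (.inr (.inr ())) a
  | .inr (.inl a) => compile A.body (fun a ↦ .inr (.inl a)) (.inr (.inr ())) a
  | .inr (.inr ()) => .branch (fun v ↦ A.done v.1) .halt (.goto fun _ ↦ .inr (.inl (entry A.body)))

variable [DecidableEq K] [Fintype K] [∀ k, Fintype (Γ k)] [Fintype σ]

/-- The enumeration machine of a looping program. -/
noncomputable def machine (A : LoopProgram Γ σ) : EnumMachine :=
  have := finite_label A.init
  have := finite_label A.body
  { K := K ⊕ Bool
    k₀ := .inl A.input
    k₁ := .inl A.output
    Γ := CompiledAlphabet Γ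
    Λ := Label A.init ⊕ Label A.body ⊕ Unit
    main := .inl (entry A.init)
    ΛFin := Fintype.ofFinite _
    σ := σ × Register Γ
    initialState := (A.initial, none)
    σFin := inferInstance
    Γk₀Fin := inferInstanceAs (Fintype (Γ A.input))
    m := A.code
    finite_alphabet := by
      rintro (k | k)
      · exact inferInstanceAs (Finite (Γ k))
      · exact inferInstanceAs (Finite (Register Γ))
    inputAlphabet := A.inputAlphabet
    outputAlphabet := A.outputAlphabet
    emit := Sum.elim (isEmit A.init) (Sum.elim (isEmit A.body) fun _ ↦ false) }

/-- The initial state of a looping program on an input word. -/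
def start (A : LoopProgram Γ σ) (w : List (Option Bool)) : State Γ σ where
  var := A.initial
  stk := update (fun _ ↦ []) A.input (w.map A.inputAlphabet.symm)
  trace := []

variable (A : LoopProgram Γ σ) {w : List (Option Bool)}

theorem implements_init : Implements A.machine.m A.machine.emit A.init .inl (.inr (.inr ())) :=
  ⟨fun _ ↦ rfl, fun _ ↦ rfl⟩

theorem implements_body :
    Implements A.machine.m A.machine.emit A.body (fun a ↦ .inr (.inl a)) (.inr (.inr ())) :=
  ⟨fun _ ↦ rfl, fun _ ↦ rfl⟩

/-- After `t` steps the machine of `A` is at the head of its loop, in the state `s`. -/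
def AtHead (w : List (Option Bool)) (t : ℕ) (s : State Γ σ) : Prop :=
  ∃ r, A.machine.configAt w t = (compiledCfg (.inr (.inr ())) s r [] []).1 ∧
    A.machine.outputs w t = s.trace

theorem configAt_zero : A.machine.configAt w 0 =
    (compiledCfg (.inl (entry A.init)) (A.start w) none [] []).1 := by
  change TM2.Cfg.mk _ _ (A.machine.configAt w 0).stk = TM2.Cfg.mk _ _ _
  rw [EnumMachine.stk_configAt_zero]
  congr 1
  refine .trans ?_ (update_compiledStacks_inl (fun _ ↦ []) [] [] A.input _)
  congr 1
  funext k
  rcases k with k | (_ | _) <;> rfl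

variable {A}

theorem atHead_of_reachesWithin {T u : ℕ} {c : A.machine.Config × List (List Bool)}
    {s : State Γ σ} {r : Register Γ}
    (h : ReachesWithin (compiledStep A.machine.m A.machine.emit A.toPorts) T c
      (compiledCfg (.inr (.inr ())) s r [] []))
    (hu : A.machine.configAt w u = c.1)
    (ho : A.machine.outputs w u = c.2 ++ (A.machine.emitted c.1).toList) :
    ∃ u' ≤ u + T, A.AtHead w u' s := by
  obtain ⟨u', hu', hc, ho'⟩ := EnumMachine.exists_outputs_of_reachesWithin h hu ho
  exact ⟨u', hu', r, hc, ho'.trans (List.append_nil _)⟩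

theorem exists_atHead_of_init {B : ℕ} {s : State Γ σ}
    (h : A.init.Runs A.toPorts B (A.start w) s) : ∃ t ≤ cost B A.init, A.AtHead w t s := by
  obtain ⟨r, hr⟩ := simulated A.toPorts B A.init A.implements_init h none []
  simpa only [Nat.zero_add] using atHead_of_reachesWithin hr A.configAt_zero
    (by rw [EnumMachine.outputs_zero, A.configAt_zero]; rfl)

theorem AtHead.step {B t : ℕ} {s s' : State Γ σ} (hs : A.AtHead w t s)
    (hdone : A.done s.var = false) (h : A.body.Runs A.toPorts B s s') :
    ∃ t' ≤ t + (cost B A.body + 1), A.AtHead w t' s' := by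
  obtain ⟨r, hc, ho⟩ := hs
  obtain ⟨r', hr⟩ := simulated A.toPorts B A.body A.implements_body h r []
  refine atHead_of_reachesWithin (.head ?_ hr) hc (ho.trans (List.append_nil _).symm)
  simp [compiledStep, compiledCfg, tracedStep, machine, code, TM2.stepAux, hdone]

theorem AtHead.halted {t : ℕ} {s : State Γ σ} (hs : A.AtHead w t s) (hdone : A.done s.var = true) :
    A.machine.HaltsWithin w (t + 1) ∧ A.machine.outputs w (t + 1) = s.trace := by
  obtain ⟨r, hc, ho⟩ := hs
  have hl : (A.machine.configAt w (t + 1)).l = none := by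
    rw [EnumMachine.configAt_succ, hc]
    simp [compiledCfg, EnumMachine.totalStep, TM2.step, machine, code, TM2.stepAux, hdone]
  refine ⟨EnumMachine.haltsWithin_iff.2 hl, ?_⟩
  rw [EnumMachine.outputs_succ, EnumMachine.emitted_of_halted hl, ho]
  exact List.append_nil _

end LoopProgram

/-! ### Polynomial bounds -/

/-- The function is given by a polynomial with natural coefficients. -/
def IsPolynomial (f : ℕ → ℕ → ℕ) : Prop :=
  ∃ q : MvPolynomial (Fin 2) ℕ, ∀ n s, MvPolynomial.eval ![n, s] q = f n s

namespace IsPolynomial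

variable {f g : ℕ → ℕ → ℕ}

theorem const (c : ℕ) : IsPolynomial fun _ _ ↦ c := ⟨.C c, by simp⟩

theorem fst : IsPolynomial fun n _ ↦ n := ⟨.X 0, by simp⟩

theorem add (hf : IsPolynomial f) (hg : IsPolynomial g) : IsPolynomial fun n s ↦ f n s + g n s :=
  let ⟨p, hp⟩ := hf
  let ⟨q, hq⟩ := hg
  ⟨p + q, by simp [hp, hq]⟩

theorem mul (hf : IsPolynomial f) (hg : IsPolynomial g) : IsPolynomial fun n s ↦ f n s * g n s :=
  let ⟨p, hp⟩ := hf
  let ⟨q, hq⟩ := hg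
  ⟨p * q, by simp [hp, hq]⟩

theorem pow (hf : IsPolynomial f) (k : ℕ) : IsPolynomial fun n s ↦ f n s ^ k :=
  let ⟨p, hp⟩ := hf
  ⟨p ^ k, by simp [hp]⟩

theorem sum {ι : Type*} [Fintype ι] {f : ι → ℕ → ℕ → ℕ} (hf : ∀ i, IsPolynomial (f i)) :
    IsPolynomial fun n s ↦ ∑ i, f i n s := by
  choose p hp using hf
  exact ⟨∑ i, p i, by simp [hp]⟩

theorem cost {K σ : Type} {Γ : K → Type} [∀ k, Fintype (Γ k)] (hf : IsPolynomial f) :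
    ∀ p : StackProgram Γ σ, IsPolynomial fun n s ↦ p.cost (f n s)
  | .push _ _ | .load _ | .emit => const 1
  | .seq p q => (cost hf p).add (cost hf q)
  | .ite _ p q => ((cost hf p).add (cost hf q)).add (const 1)
  | .pop _ b => (sum fun o ↦ cost hf (b o)).add (const 1)
  | .forEach _ b => (((const 4).mul hf).add (const 4)).add (hf.mul (sum fun c ↦ cost hf (b c)))

end IsPolynomial

theorem eval_le_eval_of_le {ι : Type*} (p : MvPolynomial ι ℕ) {x y : ι → ℕ} (h : x ≤ y) :
    MvPolynomial.eval x p ≤ MvPolynomial.eval y p := by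
  induction p using MvPolynomial.induction_on with
  | C a => simp
  | add p q hp hq => simpa using Nat.add_le_add hp hq
  | mul_X p i hp => simpa using Nat.mul_le_mul hp (h i)

theorem exists_forall_eval_le_mul_pow (p : MvPolynomial (Fin 2) ℕ) :
    ∃ C k, ∀ m n, m ≤ n → MvPolynomial.eval ![m, 1] p ≤ C * (n + 1) ^ k := by
  induction p using MvPolynomial.induction_on with
  | C a => exact ⟨a, 0, by simp⟩
  | add p q hp hq =>
    obtain ⟨C₁, k₁, h₁⟩ := hp
    obtain ⟨C₂, k₂, h₂⟩ := hq
    refine ⟨C₁ + C₂, k₁ + k₂, fun m n hmn ↦ ?_⟩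
    rw [map_add, Nat.add_mul]
    refine Nat.add_le_add ((h₁ m n hmn).trans ?_) ((h₂ m n hmn).trans ?_)
    · exact Nat.mul_le_mul_left _ (Nat.pow_le_pow_right n.succ_pos (Nat.le_add_right _ _))
    · exact Nat.mul_le_mul_left _ (Nat.pow_le_pow_right n.succ_pos (Nat.le_add_left _ _))
  | mul_X p i hp =>
    obtain ⟨C, k, h⟩ := hp
    refine ⟨C, k + 1, fun m n hmn ↦ ?_⟩
    rw [map_mul, MvPolynomial.eval_X, pow_succ, ← Nat.mul_assoc]
    refine Nat.mul_le_mul (h m n hmn) ?_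
    fin_cases i
    · exact hmn.trans n.le_succ
    · simp

namespace IncrementalEnumeration

open StackProgram

/-! ### The store of the incremental enumeration program -/

section

/-- The stacks of the program besides those of the simulated machine: the input graph `inp`, the
output word `out`, the unary step budget `budget`, a vector `ones` with an entry per vertex, the
vertex set `cur` on whose induced subgraph the machine is run, the code `word` of that subgraph, the
output words `res` of the run, the solutions `found` so far, and the arguments, zippers and scratch
stacks of the procedures. -/
inductive OwnStack
  | inp | out | budget | ones | cur | word | copy | res | recorded | block | arg | left | right
  | outerLeft | outerRight | cmp | tmp | found
  deriving DecidableEq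

instance : Fintype OwnStack where
  elems := {.inp, .out, .budget, .ones, .cur, .word, .copy, .res, .recorded, .block, .arg, .left,
    .right, .outerLeft, .outerRight, .cmp, .tmp, .found}
  complete k := by cases k <;> simp

/-- The alphabets of the program's own stacks. -/
@[reducible] def OwnStack.Alphabet : OwnStack → Type
  | inp | word | copy | res | recorded | found => Option Bool
  | out | budget | ones | cur | block | arg | left | right | outerLeft | outerRight | cmp
  | tmp => Bool

instance (k : OwnStack) : Fintype k.Alphabet := by cases k <;> infer_instance

/-- The control variables of the program: the control label and the variables of the simulated
machine, and the flags of the procedures. -/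
@[ext] structure Control (M : EnumMachine) where
  label : Option M.Λ
  var : M.σ
  allTrue : Bool
  full : Bool
  halted : Bool
  solved : Bool
  known : Bool
  same : Bool
  finished : Bool

instance (M : EnumMachine) : Finite (Control M) := by
  have := M.ΛFin
  have := M.σFin
  refine Finite.of_injective (β := Option M.Λ × M.σ × (Fin 7 → Bool))
    (fun c ↦ (c.label, c.var,
      ![c.allTrue, c.full, c.halted, c.solved, c.known, c.same, c.finished])) fun c d h ↦ ?_
  simp only [Prod.mk.injEq, Matrix.vecCons_inj] at h
  ext <;> simp [h]

/-- The stack alphabets of the program. -/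
@[reducible] def Alphabet (M : EnumMachine) : M.K ⊕ OwnStack → Type
  | .inl k => M.Γ k
  | .inr k => k.Alphabet

/-- The state of the program, with one field for each of its own stacks. -/
structure Store (M : EnumMachine) where
  control : Control M
  simulated : ∀ k, List (M.Γ k)
  inp : List (Option Bool)
  out : List Bool
  budget : List Bool
  ones : List Bool
  cur : List Bool
  word : List (Option Bool)
  copy : List (Option Bool)
  res : List (Option Bool)
  recorded : List (Option Bool)
  block : List Bool
  arg : List Bool
  left : List Bool
  right : List Bool
  outerLeft : List Bool
  outerRight : List Bool
  cmp : List Bool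
  tmp : List Bool
  found : List (Option Bool)
  trace : List (List Bool)

variable {M : EnumMachine}

namespace Store

/-- The content of a stack. -/
def get (s : Store M) : ∀ k, List (Alphabet M k)
  | .inl k => s.simulated k
  | .inr .inp => s.inp
  | .inr .out => s.out
  | .inr .budget => s.budget
  | .inr .ones => s.ones
  | .inr .cur => s.cur
  | .inr .word => s.word
  | .inr .copy => s.copy
  | .inr .res => s.res
  | .inr .recorded => s.recorded
  | .inr .block => s.block
  | .inr .arg => s.arg
  | .inr .left => s.left
  | .inr .right => s.right
  | .inr .outerLeft => s.outerLeft
  | .inr .outerRight => s.outerRight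
  | .inr .cmp => s.cmp
  | .inr .tmp => s.tmp
  | .inr .found => s.found

/-- Replace the content of a stack. -/
def set (s : Store M) : ∀ k, List (Alphabet M k) → Store M
  | .inl k, x => { s with simulated := update s.simulated k x }
  | .inr .inp, x => { s with inp := x }
  | .inr .out, x => { s with out := x }
  | .inr .budget, x => { s with budget := x }
  | .inr .ones, x => { s with ones := x }
  | .inr .cur, x => { s with cur := x }
  | .inr .word, x => { s with word := x }
  | .inr .copy, x => { s with copy := x }
  | .inr .res, x => { s with res := x }
  | .inr .recorded, x => { s with recorded := x }
  | .inr .block, x => { s with block := x }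
  | .inr .arg, x => { s with arg := x }
  | .inr .left, x => { s with left := x }
  | .inr .right, x => { s with right := x }
  | .inr .outerLeft, x => { s with outerLeft := x }
  | .inr .outerRight, x => { s with outerRight := x }
  | .inr .cmp, x => { s with cmp := x }
  | .inr .tmp, x => { s with tmp := x }
  | .inr .found, x => { s with found := x }

variable (s : Store M) (k : M.K ⊕ OwnStack) (x y : List (Alphabet M k))

theorem get_set : (s.set k x).get = update s.get k x := by
  funext j
  rcases eq_or_ne j k with rfl | hj
  · rw [update_self]
    rcases j with j | j
    · exact update_self ..
    · cases j <;> rfl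
  · rw [update_of_ne hj]
    rcases k with k | k <;> rcases j with j | j
    · exact update_of_ne (fun h ↦ hj (congrArg Sum.inl h)) ..
    · cases j <;> rfl
    · cases k <;> rfl
    · cases k <;> cases j <;> first | rfl | exact absurd rfl hj

theorem get_set_self : (s.set k x).get k = x := by
  rw [get_set, update_self]

theorem set_set : (s.set k x).set k y = s.set k y := by
  rcases k with k | k
  · simp [set]
  · cases k <;> rfl

theorem set_get : s.set k (s.get k) = s := by
  rcases k with k | k
  · simp [set, get]
  · cases k <;> rfl

/-- The store as a state of the programming language. -/
def toState : State (Alphabet M) (Control M) where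
  var := s.control
  stk := s.get
  trace := s.trace

theorem toState_set : (s.set k x).toState =
    { s.toState with stk := update s.toState.stk k x } := by
  refine State.ext ?_ (get_set s k x) ?_ <;> rcases k with k | k
  · rfl
  · cases k <;> rfl
  · rfl
  · cases k <;> rfl

end Store

/-! ### Execution of procedures -/

/-- Programs over the stacks of the incremental enumeration program. -/
abbrev Procedure (M : EnumMachine) : Type := StackProgram (Alphabet M) (Control M)

/-- The graph is read from the stack `inp`, and the stack `out` is emitted. -/
def ports (M : EnumMachine) : Ports (Alphabet M) where
  input := .inr .inp
  output := .inr .out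
  inputAlphabet := .refl _
  outputAlphabet := .refl _

/-- The procedure `p` leads from `s` to `s'`, and all its loops have length at most `B`. -/
def Executes (B : ℕ) (p : Procedure M) (s s' : Store M) : Prop :=
  p.Runs (ports M) B s.toState s'.toState

variable {B : ℕ} {s s₁ s₂ s' : Store M} {k a b : M.K ⊕ OwnStack} {p q : Procedure M}

namespace Executes

theorem of_eq (h₁ : Executes B p s s₁) (h₂ : s₁ = s') : Executes B p s s' := h₂ ▸ h₁

theorem seq (h₁ : Executes B p s s₁) (h₂ : Executes B q s₁ s₂) : Executes B (.seq p q) s s₂ :=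
  ⟨_, h₁, h₂⟩

theorem push {f : Control M → Alphabet M k} :
    Executes B (.push k f) s (s.set k (f s.control :: s.get k)) := by
  rw [Executes, Store.toState_set]
  rfl

theorem load {f : Control M → Control M} :
    Executes B (.load f) s { s with control := f s.control } := rfl

theorem emit : Executes B .emit s { s with trace := s.trace ++ [s.out] } :=
  congrArg (fun x ↦ State.mk s.control s.get (s.trace ++ [x])) (List.map_id s.out).symm

theorem ite {c : Control M → Bool} (h₁ : c s.control = true → Executes B p s s')
    (h₂ : c s.control = false → Executes B q s s') : Executes B (.ite c p q) s s' := by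
  change bif c s.control then Executes B p s s' else Executes B q s s'
  cases h : c s.control
  · exact h₂ h
  · exact h₁ h

theorem pop {f : Option (Alphabet M k) → Procedure M}
    (h : Executes B (f (s.get k).head?) (s.set k (s.get k).tail) s') :
    Executes B (.pop k f) s s' := by
  rw [Executes, Store.toState_set] at h
  exact h

theorem forEach {f : Alphabet M k → Procedure M} {l : List (Alphabet M k)} (hl : s.get k = l)
    (hB : l.length ≤ B) (h : Traverse (fun c ↦ Executes B (f c)) l s s') :
    Executes B (.forEach k f) s s' := by
  subst hl
  exact ⟨hB, h.map fun _ _ _ ↦ id⟩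

end Executes

/-- The program that does nothing. -/
def skip : Procedure M := .load id

theorem Executes.skip : Executes B (skip : Procedure M) s s := rfl

/-- Push the symbols of `a` on `b`, in reverse order. -/
def pour (a b : M.K ⊕ OwnStack) (f : Alphabet M a → Alphabet M b) : Procedure M :=
  .forEach a fun c ↦ .push b fun _ ↦ f c

theorem Executes.pour {f : Alphabet M a → Alphabet M b} (hB : (s.get a).length ≤ B) :
    Executes B (pour a b f) s (s.set b (((s.get a).map f).reverse ++ s.get b)) := by
  refine .forEach rfl hB ?_
  clear hB
  generalize s.get a = l
  induction l generalizing s with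
  | nil => exact s.set_get b
  | cons c l ih =>
    refine .cons .push ?_
    have := ih (s := s.set b (f c :: s.get b))
    simpa [Store.set_set, Store.get_set_self] using this

/-- Empty the stack `a`. -/
def clear (a : M.K ⊕ OwnStack) : Procedure M :=
  .forEach a fun _ ↦ .pop a fun _ ↦ skip

theorem Executes.clear (hB : (s.get a).length ≤ B) : Executes B (clear a) s (s.set a []) := by
  refine .forEach rfl hB ?_
  clear hB
  generalize hl : s.get a = l
  induction l generalizing s with
  | nil => exact (congrArg (s.set a) hl).symm.trans (s.set_get a)
  | cons c l ih =>
    refine .cons (.pop .skip) ?_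
    have := ih (s := s.set a (s.get a).tail) (by rw [Store.get_set_self, hl, List.tail_cons])
    rwa [Store.set_set] at this

/-- Move the symbols of `a` to `b`, in reverse order. -/
def move (a b : M.K ⊕ OwnStack) (f : Alphabet M a → Alphabet M b) : Procedure M :=
  .seq (pour a b f) (clear a)

theorem Executes.move {f : Alphabet M a → Alphabet M b} (hab : a ≠ b)
    (hB : (s.get a).length ≤ B) :
    Executes B (move a b f) s ((s.set b (((s.get a).map f).reverse ++ s.get b)).set a []) :=
  .seq (.pour hB) (.clear (by rwa [Store.get_set, update_of_ne hab]))

/-! ### Simulation of a machine -/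

/-- Empty all stacks of the simulated machine. -/
noncomputable def clearSimulated : Procedure M :=
  M.kFin.elems.toList.foldr (fun k p ↦ .seq (clear (.inl k)) p) skip

theorem Executes.clearSimulated (hB : ∀ k, (s.simulated k).length ≤ B) :
    Executes B clearSimulated s { s with simulated := fun _ ↦ [] } := by
  suffices ∀ (l : List M.K) (s : Store M), (∀ k ∈ l, (s.simulated k).length ≤ B) →
      Executes B (l.foldr (fun k p ↦ .seq (IncrementalEnumeration.clear (.inl k)) p)
        IncrementalEnumeration.skip) s
        { s with simulated := fun k ↦ if k ∈ l then [] else s.simulated k } by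
    refine (this _ s fun k _ ↦ hB k).of_eq ?_
    simp [M.kFin.complete]
  intro l
  induction l with
  | nil => intro s _; exact .skip
  | cons k l ih =>
    intro s hB
    refine .seq (.clear (hB k List.mem_cons_self)) ((ih _ fun j hj ↦ ?_).of_eq ?_)
    · rcases eq_or_ne j k with rfl | hjk
      · simp [Store.set]
      · simpa [Store.set, hjk] using hB j (List.mem_cons_of_mem k hj)
    · simp only [Store.set, Store.mk.injEq, true_and, and_true]
      funext j
      rcases eq_or_ne j k with rfl | hjk <;> simp [*]

/-- The configuration of the simulated machine. -/
def Store.config (s : Store M) : M.Config := ⟨s.control.label, s.control.var, s.simulated⟩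

/-- Replace the configuration of the simulated machine. -/
def Store.setConfig (s : Store M) (c : M.Config) : Store M :=
  { s with control := { s.control with label := c.l, var := c.var }, simulated := c.stk }

/-- The program that executes a statement of the simulated machine. -/
def ofStmt : TM2.Stmt M.Γ M.Λ M.σ → Procedure M
  | .push k f q => .seq (.push (.inl k) fun c ↦ f c.var) (ofStmt q)
  | .peek k f q => .seq (.pop (.inl k) fun o ↦ .seq (.load fun c ↦ { c with var := f c.var o })
      (o.elim skip fun a ↦ .push (.inl k) fun _ ↦ a)) (ofStmt q)
  | .pop k f q => .seq (.pop (.inl k) fun o ↦ .load fun c ↦ { c with var := f c.var o }) (ofStmt q)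
  | .load f q => .seq (.load fun c ↦ { c with var := f c.var }) (ofStmt q)
  | .branch f p q => .ite (fun c ↦ f c.var) (ofStmt p) (ofStmt q)
  | .goto f => .load fun c ↦ { c with label := some (f c.var) }
  | .halt => .load fun c ↦ { c with label := none }

theorem Executes.ofStmt : ∀ (q : TM2.Stmt M.Γ M.Λ M.σ) (s : Store M),
    Executes B (ofStmt q) s (s.setConfig (TM2.stepAux q s.control.var s.simulated))
  | .push _ _ q, _ => .seq .push (Executes.ofStmt q _)
  | .peek k f q, s => by
    refine .seq (s₁ := { s with control :=
      { s.control with var := f s.control.var (s.simulated k).head? } })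
      (.pop (.seq .load ?_)) (Executes.ofStmt q _)
    change Executes B (Option.elim (s.simulated k).head? _ _)
      { s with
        control := { s.control with var := f s.control.var (s.simulated k).head? }
        simulated := update s.simulated k (s.simulated k).tail } _
    cases h : s.simulated k with
    | nil => exact Executes.skip.of_eq (by rw [List.tail_nil, ← h, update_eq_self])
    | cons a l => exact Executes.push.of_eq (by simp [Store.set, Store.get, h])
  | .pop _ _ q, _ => .seq (.pop .load) (Executes.ofStmt q _)
  | .load _ q, _ => .seq .load (Executes.ofStmt q _)
  | .branch _ p q, s =>
    .ite (fun h ↦ by simpa only [TM2.stepAux, h, cond_true] using Executes.ofStmt p s)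
      fun h ↦ by simpa only [TM2.stepAux, h, cond_false] using Executes.ofStmt q s
  | .goto _, _ => .load
  | .halt, _ => .load

open Classical in
/-- The program for one step of the simulated machine. -/
noncomputable def stepSimulated : Procedure M :=
  M.ΛFin.elems.toList.foldr
    (fun l p ↦ .ite (fun c ↦ decide (c.label = some l)) (ofStmt (M.m l)) p) skip

theorem Executes.stepSimulated :
    Executes B stepSimulated s (s.setConfig (M.totalStep s.config)) := by
  classical
  suffices ∀ ls : List M.Λ, (∀ l, s.control.label = some l → l ∈ ls) →
      Executes B (ls.foldr (fun l p ↦ .ite (fun c ↦ decide (c.label = some l))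
        (IncrementalEnumeration.ofStmt (M.m l)) p) IncrementalEnumeration.skip) s
        (s.setConfig (M.totalStep s.config)) by
    exact this _ fun l _ ↦ Finset.mem_toList.2 (M.ΛFin.complete l)
  intro ls
  induction ls with
  | nil =>
    intro h
    have hl : s.config.l = none := Option.eq_none_iff_forall_ne_some.2 fun l hl ↦
      List.not_mem_nil (h l hl)
    rw [M.totalStep_of_halted hl]
    exact .skip
  | cons l ls ih =>
    refine fun h ↦ .ite (fun hl ↦ ?_) fun hl ↦ ih fun l' hl' ↦ ?_
    · have hl : s.control.label = some l := by simpa using hl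
      have hstep : M.totalStep s.config = TM2.stepAux (M.m l) s.control.var s.simulated := by
        simp [EnumMachine.totalStep, Store.config, hl, TM2.step]
      exact hstep ▸ Executes.ofStmt (M.m l) s
    · refine (List.mem_cons.1 (h l' hl')).resolve_left ?_
      rintro rfl
      simp [hl'] at hl

end

/-! ### Runs on induced subgraphs -/

section

variable {M : EnumMachine} {B : ℕ} {s s₁ s₂ s' : Store M}

/-- Handle one matrix entry on `copy` whose row is selected if `r` and whose column is selected
if `c`. -/
def selectEntry (r c : Bool) : Procedure M :=
  .pop (.inr .copy) fun o ↦ bif r && c then .push (.inr .word) fun _ ↦ o.getD none else skip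

/-- Handle one row of the matrix on `copy`, which is selected if `r`. -/
def selectRow (r : Bool) : Procedure M :=
  .seq (.forEach (.inr .cur) (selectEntry r)) <|
    .pop (.inr .copy) fun _ ↦ bif r then .push (.inr .word) fun _ ↦ none else skip

/-- Write the code of the subgraph induced by `cur` on the input stack of the simulated machine. -/
def loadInducedGraph : Procedure M :=
  .seq (pour (.inr .inp) (.inr .word) id) <|
  .seq (move (.inr .word) (.inr .copy) id) <|
  .seq (.forEach (.inr .cur) selectRow) <|
    move (.inr .word) (.inl M.k₀) M.inputAlphabet.symm

theorem traverse_selectEntry {α : Type} (r : Bool) (c f : α → Bool) {rest : List (Option Bool)}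
    {xs : List α} (h : s.copy = (xs.map f).map some ++ rest) :
    Traverse (fun c ↦ Executes B (selectEntry r c)) (xs.map c) s { s with
      copy := rest
      word := (bif r then ((xs.filter c).map f).map some else []).reverse ++ s.word } := by
  induction xs generalizing s with
  | nil =>
    obtain rfl : s.copy = rest := h
    cases r <;> rfl
  | cons x xs ih =>
    refine .cons (.pop (s' := { s with
        copy := (xs.map f).map some ++ rest
        word := (bif r && c x then [some (f x)] else []) ++ s.word }) ?_) ?_
    · change Executes B
        (bif r && c x then .push (.inr .word) fun _ ↦ s.copy.head?.getD none else skip)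
        { s with copy := s.copy.tail } _
      rw [h]
      cases r && c x
      · exact .skip
      · exact .push
    · refine .of_eq (ih rfl) ?_
      cases r <;> cases hx : c x <;> simp [hx]

section

variable {n : ℕ} {G : SimpleGraph (Fin n)} {S : Set (Fin n)}

theorem Executes.selectRow (r : Bool) {i : Fin n} {rest : List (Option Bool)} (hB : n ≤ B)
    (hcur : s.cur = vertexSetCode S)
    (hcopy : s.copy = (adjRow G (List.finRange n) i).map some ++ none :: rest) :
    Executes B (selectRow r) s { s with
      copy := rest
      word := (bif r then (adjRow G (vertexList S) i).map some ++ [none] else []).reverse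
        ++ s.word } := by
  classical
  rw [vertexSetCode_eq_map_boolIndicator] at hcur
  refine .seq (.forEach hcur (by simpa using hB) (traverse_selectEntry r _ _ hcopy)) (.pop ?_)
  cases r
  · exact .skip
  · exact Executes.push.of_eq (by simp [Store.set, Store.get, adjRow, vertexList])

theorem traverse_selectRow {xs : List (Fin n)} (hB : n ≤ B) (hcur : s.cur = vertexSetCode S)
    (hcopy : s.copy = separated (xs.map (adjRow G (List.finRange n)))) :
    Traverse (fun r ↦ Executes B (selectRow r)) (xs.map S.boolIndicator) s { s with
      copy := []
      word := (separated ((xs.filter S.boolIndicator).map (adjRow G (vertexList S)))).reverse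
        ++ s.word } := by
  induction xs generalizing s with
  | nil =>
    obtain ⟨⟩ := s
    obtain rfl : _ = [] := hcopy
    rfl
  | cons x xs ih =>
    refine .cons (.selectRow _ hB hcur (by rw [hcopy, List.map_cons, separated_cons])) ?_
    refine .of_eq (ih hcur rfl) ?_
    cases hx : S.boolIndicator x <;> simp [hx]

theorem length_graphCode_inducedGraph_le (hB : n * (n + 1) ≤ B) :
    (graphCode (inducedGraph G S)).length ≤ B := by
  rw [length_graphCode]
  have hle := length_vertexList_le S
  exact (Nat.mul_le_mul hle (Nat.succ_le_succ hle)).trans hB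

theorem Executes.loadInducedGraph (hB : n * (n + 1) ≤ B) (hinp : s.inp = graphCode G)
    (hcur : s.cur = vertexSetCode S) (hword : s.word = []) (hcopy : s.copy = [])
    (hsim : s.simulated = fun _ ↦ []) :
    Executes B loadInducedGraph s { s with
      simulated := (M.configAt (graphCode (inducedGraph G S)) 0).stk } := by
  have hn : n ≤ B := by
    rcases n with _ | n
    · exact Nat.zero_le B
    · exact (Nat.le_mul_of_pos_right _ (n + 1).succ_pos).trans hB
  have hG : (graphCode G).length ≤ B := by rwa [length_graphCode]
  refine .seq (s₁ := { s with word := (graphCode G).reverse }) ?_ <|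
    .seq (s₁ := { s with copy := graphCode G }) ?_ <|
    .seq (s₁ := { s with word := (graphCode (inducedGraph G S)).reverse }) ?_ ?_
  · exact (Executes.pour (by simpa [Store.get, hinp] using hG)).of_eq
      (by simp [Store.set, Store.get, hinp, hword])
  · exact (Executes.move (by simp) (by simpa [Store.get] using hG)).of_eq
      (by simp [Store.set, Store.get, hcopy, hword])
  · have h := traverse_selectRow (B := B) (s := { s with copy := graphCode G }) hn hcur
      (graphCode_eq_separated G)
    rw [← vertexSetCode_eq_map_boolIndicator, ← vertexList, ← graphCode_inducedGraph] at h
    exact .forEach hcur (by simpa using hn) (by simpa [hword, hcopy] using h)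
  · refine (Executes.move (by simp) ?_).of_eq ?_
    · simpa [Store.get] using length_graphCode_inducedGraph_le (G := G) hB
    · rw [EnumMachine.stk_configAt_zero]
      simp [Store.set, Store.get, hword, hsim]

end

/-- Record the output word of the simulated machine on `res`. -/
def recordWord : Procedure M :=
  .seq (.forEach (.inl M.k₁) fun a ↦
    .seq (.push (.inr .res) fun _ ↦ some (M.outputAlphabet a))
      (.load fun c ↦ { c with allTrue := c.allTrue && M.outputAlphabet a })) <|
  .seq (.push (.inr .res) fun _ ↦ none)
    (.load fun c ↦ { c with full := c.full || c.allTrue, allTrue := true })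

/-- Record what the simulated machine outputs in its current configuration. -/
def record : Procedure M := .ite (fun c ↦ c.label.elim false M.emit) recordWord skip

/-- Run the machine on the subgraph induced by `cur` within the step budget `budget`. The output
words are recorded on `res`, the flag `halted` tells whether the machine has halted, and the flag
`full` whether an output word consists of all vertices. -/
noncomputable def run : Procedure M :=
  .seq loadInducedGraph <|
  .seq (.load fun c ↦ { c with label := some M.main, var := M.initialState, full := false }) <|
  .seq record <|
  .seq (.forEach (.inr .budget) fun _ ↦ .seq stepSimulated record) <|
  .seq (.load fun c ↦
    { c with halted := c.label.isNone, label := none, var := M.initialState })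
    clearSimulated

theorem Executes.recordWord (hB : (s.simulated M.k₁).length ≤ B)
    (hs : s.control.allTrue = true) :
    Executes B recordWord s { s with
      control := { s.control with
        full := s.control.full || ((s.simulated M.k₁).map M.outputAlphabet).all id }
      res := none :: ((s.simulated M.k₁).map M.outputAlphabet).reverse.map some ++ s.res } := by
  suffices ∀ (l : List (M.Γ M.k₁)) (s : Store M), Traverse (fun a ↦ Executes B (.seq
      (.push (.inr .res) fun _ ↦ some (M.outputAlphabet a))
      (.load fun c ↦ { c with allTrue := c.allTrue && M.outputAlphabet a }))) l s { s with
        control := { s.control with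
          allTrue := s.control.allTrue && (l.map M.outputAlphabet).all id }
        res := (l.map M.outputAlphabet).reverse.map some ++ s.res } from
    .seq (.forEach rfl hB (this _ s)) (.seq .push (Executes.load.of_eq
      (by simp [Store.set, Store.get, hs])))
  intro l
  induction l with
  | nil => intro s; simp [Traverse]
  | cons a l ih =>
    refine fun s ↦ .cons (.seq .push .load) ?_
    exact .of_eq (ih _) (by simp [Store.set, Store.get, Bool.and_assoc])

theorem Executes.record (hB : (s.simulated M.k₁).length ≤ B) (hs : s.control.allTrue = true) :
    Executes B record s { s with
      control := { s.control with
        full := s.control.full || (M.emitted s.config).toList.any fun x ↦ x.all id }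
      res := (separated (M.emitted s.config).toList).reverse ++ s.res } := by
  have hemitted : M.emitted s.config = match s.control.label with
    | none => none
    | some l => if M.emit l then some ((s.simulated M.k₁).map M.outputAlphabet) else none := rfl
  refine .ite (fun h ↦ (Executes.recordWord hB hs).of_eq ?_) fun h ↦ Executes.skip.of_eq ?_ <;>
    rw [hemitted] <;> clear hs hemitted
  all_goals
    generalize s.control.label = l at h
    cases l <;> simp_all

/-- The store during the simulated run on the input word `w`, after `t` steps. -/
def Store.simulating (s : Store M) (w : List (Option Bool)) (t : ℕ) : Store M :=
  { s with
    control := { s.control with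
      label := (M.configAt w t).l
      var := (M.configAt w t).var
      full := (M.outputs w t).any fun x ↦ x.all id }
    simulated := (M.configAt w t).stk
    res := (separated (M.outputs w t)).reverse ++ s.res }

theorem Executes.record_simulating {w : List (Option Bool)} {t : ℕ}
    (hB : ((M.configAt w (t + 1)).stk M.k₁).length ≤ B) (hs : s.control.allTrue = true) :
    Executes B (.seq IncrementalEnumeration.stepSimulated IncrementalEnumeration.record)
      (s.simulating w t) (s.simulating w (t + 1)) := by
  have hstep : M.totalStep (s.simulating w t).config = M.configAt w (t + 1) :=
    (M.configAt_succ w t).symm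
  refine .seq .stepSimulated ?_
  rw [hstep]
  refine .of_eq (.record hB hs) ?_
  simp [Store.simulating, Store.setConfig, Store.config, EnumMachine.outputs_succ]

/-- The simulated machine is reset, and the scratch stacks of `run` are empty. -/
structure Store.Idle (s : Store M) : Prop where
  label : s.control.label = none
  var : s.control.var = M.initialState
  allTrue : s.control.allTrue = true
  simulated : s.simulated = fun _ ↦ []
  word : s.word = []
  copy : s.copy = []

open Classical in
theorem Executes.run {n : ℕ} {G : SimpleGraph (Fin n)} {S : Set (Fin n)} {T : ℕ}
    (hG : n * (n + 1) ≤ B) (hT : T ≤ B)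
    (hB : ∀ t ≤ T, ∀ k, ((M.configAt (graphCode (inducedGraph G S)) t).stk k).length ≤ B)
    (hs : s.Idle) (hinp : s.inp = graphCode G) (hcur : s.cur = vertexSetCode S)
    (hbudget : s.budget = List.replicate T true) :
    Executes B run s { s with
      control := { s.control with
        full := (M.outputs (graphCode (inducedGraph G S)) T).any fun x ↦ x.all id
        halted := decide (M.HaltsWithin (graphCode (inducedGraph G S)) T) }
      res := (separated (M.outputs (graphCode (inducedGraph G S)) T)).reverse ++ s.res } := by
  set w := graphCode (inducedGraph G S)
  refine .seq (.loadInducedGraph hG hinp hcur hs.word hs.copy hs.simulated) <| .seq .load <|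
    .seq (s₁ := s.simulating w 0) ?_ <| .seq (s₁ := s.simulating w T) ?_ <|
    .seq .load ((Executes.clearSimulated (hB T le_rfl)).of_eq ?_)
  · refine .of_eq (.record (hB 0 T.zero_le M.k₁) hs.allTrue) ?_
    rw [Store.simulating, EnumMachine.outputs_zero]
    rfl
  · refine .forEach hbudget (by simpa using hT) ?_
    have h := Traverse.of_forall_getElem (l := List.replicate T true) (I := s.simulating w)
      (R := fun _ ↦ Executes B
        (.seq IncrementalEnumeration.stepSimulated IncrementalEnumeration.record)) fun t ht ↦
        .record_simulating (hB (t + 1) (by simpa using ht) M.k₁) hs.allTrue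
    rwa [List.length_replicate] at h
  · have hhalted : decide (M.HaltsWithin w T) = (M.configAt w T).l.isNone := by
      rw [Bool.eq_iff_iff, decide_eq_true_iff, EnumMachine.haltsWithin_iff,
        Option.isNone_iff_eq_none]
    simp [Store.simulating, hhalted, hs.label, hs.var, hs.simulated]

end

/-! ### Membership tests and greedy extension -/

section

variable {M : EnumMachine} {B : ℕ} {s s₁ s₂ s' : Store M}

/-- The machine `M` halts on the subgraph of `G` induced by `S` within `T` steps. -/
abbrev HaltsOn (M : EnumMachine) {n : ℕ} (G : SimpleGraph (Fin n)) (T : ℕ) (S : Set (Fin n)) :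
    Prop :=
  M.HaltsWithin (graphCode (inducedGraph G S)) T

/-- The machine solves the problem on all induced subgraphs of `G`, on those in the class within the
step budget `T`, and `B` bounds the words that occur when it is run within this budget. -/
structure Adequate (M : EnumMachine) (P : GraphClass) {n : ℕ} (G : SimpleGraph (Fin n))
    (T B : ℕ) : Prop where
  enumeratesWithin : ∀ S, ∃ t, M.EnumeratesWithin P (inducedGraph G S) t
  haltsOn : ∀ S, P.IsSetOf G S → HaltsOn M G T S
  length_graphCode_le : n * (n + 1) ≤ B
  length_stk_le : ∀ S, ∀ t ≤ T, ∀ k,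
    ((M.configAt (graphCode (inducedGraph G S)) t).stk k).length ≤ B
  length_outputs_le : (T + 1) * (n + 1) ≤ B

/-- Between the runs, the store contains the graph `G` and the step budget `T`, the simulated
machine is reset, and the flags and stacks that the membership test uses are reset as well. -/
structure Store.Ready {n : ℕ} (s : Store M) (G : SimpleGraph (Fin n)) (T : ℕ) : Prop
    extends s.Idle where
  inp : s.inp = graphCode G
  budget : s.budget = List.replicate T true
  ones : s.ones = List.replicate n true
  cur : s.cur = []
  res : s.res = []
  cmp : s.cmp = []
  tmp : s.tmp = []
  full : s.control.full = false
  halted : s.control.halted = false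
  known : s.control.known = false
  same : s.control.same = false

/-- Run the machine on the subgraph induced by `cur`, and forget this set and the recorded words. -/
noncomputable def test : Procedure M := .seq run <| .seq (clear (.inr .res)) (clear (.inr .cur))

/-- Put the list with the bit `b` at its current position on `cur`, where the programs `right` and
`left` copy the parts of the list beyond and before this position. -/
def plug (b : Bool) (right left : Procedure M) : Procedure M :=
  .seq right <| .seq (move (.inr .tmp) (.inr .cur) id) <| .seq (.push (.inr .cur) fun _ ↦ b) left

/-- Extend the set on the zipper `left`, `right` by its current vertex, if this is possible, and
proceed to the next vertex. -/
noncomputable def extendStep : Procedure M :=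
  .pop (.inr .right) fun o ↦
    .seq (plug true (pour (.inr .right) (.inr .tmp) id) (pour (.inr .left) (.inr .cur) id)) <|
    .seq test <| .seq (.push (.inr .left) fun c ↦ c.full || o.getD false)
      (.load fun c ↦ { c with full := false, halted := false })

/-- Extend the set on `right` greedily, and leave the result on `left`. -/
noncomputable def extend : Procedure M := .forEach (.inr .ones) fun _ ↦ extendStep

theorem Executes.plug {b : Bool} {right left : Procedure M} {x : List Bool} {i : ℕ}
    (hx : x.length ≤ B) (hi : i < x.length) (htmp : s.tmp = []) (hcur : s.cur = [])
    (hright : Executes B right s { s with tmp := (x.drop (i + 1)).reverse })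
    (hleft : ∀ y, Executes B left { s with cur := y } { s with cur := x.take i ++ y }) :
    Executes B (plug b right left) s { s with cur := x.set i b } := by
  have hdrop : (x.drop (i + 1)).length ≤ B := by
    rw [List.length_drop]
    exact (Nat.sub_le _ _).trans hx
  refine .seq hright <| .seq (s₁ := { s with cur := x.drop (i + 1) }) ?_ <| .seq .push ?_
  · refine (Executes.move (by simp) (by simpa [Store.get] using hdrop)).of_eq ?_
    simp [Store.set, Store.get, hcur, htmp]
  · rw [List.set_eq_take_append_cons_drop, if_pos hi]
    exact hleft _

section

variable {P : GraphClass} {n T : ℕ} {G : SimpleGraph (Fin n)} {S U : Set (Fin n)}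

theorem take_succ_set {α : Type*} {x : List α} {i : ℕ} (hi : i < x.length) (a : α) :
    (x.set i a).take (i + 1) = x.take i ++ [a] := by
  simp [List.set_eq_take_append_cons_drop, hi, List.take_append, Nat.min_eq_left hi.le]

namespace Adequate

theorem le (h : Adequate M P G T B) : n ≤ B :=
  (Nat.le_mul_of_pos_left _ T.succ_pos).trans ((Nat.mul_le_mul_left _ n.le_succ).trans
    h.length_outputs_le)

theorem length_vertexSetCode_le (h : Adequate M P G T B) (S : Set (Fin n)) :
    (vertexSetCode S).length ≤ B :=
  (length_vertexSetCode S).trans_le h.le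

theorem budget_le (h : Adequate M P G T B) : T ≤ B :=
  T.le_succ.trans ((Nat.le_mul_of_pos_right _ n.succ_pos).trans h.length_outputs_le)

open Classical in
theorem any_all_outputs (h : Adequate M P G T B) (S : Set (Fin n)) :
    ((M.outputs (graphCode (inducedGraph G S)) T).any fun x ↦ x.all id) =
      decide (P.IsSetOf G S) := by
  obtain ⟨t, ht⟩ := h.enumeratesWithin S
  rw [Bool.eq_iff_iff, decide_eq_true_iff, ← GraphClass.isSetOf_inducedGraph_univ]
  exact ht.any_all_outputs fun hS ↦ h.haltsOn S (GraphClass.isSetOf_inducedGraph_univ.1 hS)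

theorem length_separated_outputs_le (h : Adequate M P G T B) (S : Set (Fin n)) :
    (separated (M.outputs (graphCode (inducedGraph G S)) T)).length ≤ B := by
  obtain ⟨t, ht⟩ := h.enumeratesWithin S
  obtain ⟨Us, hUs, -⟩ := ht.exists_outputs_eq_map T
  rw [length_separated (n := (vertexList S).length) (by simp [hUs])]
  exact (Nat.mul_le_mul (M.length_outputs_le _ T)
    (Nat.succ_le_succ (length_vertexList_le S))).trans h.length_outputs_le

end Adequate

open Classical in
theorem Executes.run_of_ready (h : Adequate M P G T B) (hs : s.Ready G T) :
    Executes B IncrementalEnumeration.run { s with cur := vertexSetCode S } { s with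
      control := { s.control with
        full := decide (P.IsSetOf G S)
        halted := decide (HaltsOn M G T S) }
      cur := vertexSetCode S
      res := (separated (M.outputs (graphCode (inducedGraph G S)) T)).reverse } := by
  refine .of_eq (.run h.length_graphCode_le h.budget_le (h.length_stk_le S)
    { hs.toIdle with } hs.inp rfl hs.budget) ?_
  simp [h.any_all_outputs, hs.res]

open Classical in
theorem Executes.test (h : Adequate M P G T B) (hs : s.Ready G T) :
    Executes B test { s with cur := vertexSetCode S } { s with control := { s.control with
      full := decide (P.IsSetOf G S)
      halted := decide (HaltsOn M G T S) } } := by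
  refine .seq (.run_of_ready h hs) <| .seq (.clear ?_) ((Executes.clear ?_).of_eq ?_)
  · simpa [Store.get] using h.length_separated_outputs_le S
  · exact h.length_vertexSetCode_le S
  · simp [Store.set, hs.cur, hs.res]

theorem vertexSetCode_greedyExtend_singleton (i : Fin n) {b : Bool}
    (hb : b = true ↔ P.IsSetOf G (insert i U)) :
    vertexSetCode (P.greedyExtend G [i] U) =
      (vertexSetCode U).set i (b || U.boolIndicator i) := by
  rw [GraphClass.greedyExtend_cons]
  split_ifs with hi
  · rw [hb.2 hi, Bool.true_or, ← vertexSetCode_insert]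
    rfl
  · rw [Bool.eq_false_iff.2 (hb.not.2 hi), Bool.false_or, ← getElem_vertexSetCode U (by simp),
      List.set_getElem_self]
    rfl

theorem Executes.extendStep (h : Adequate M P G T B) (hs : s.Ready G T) (i : Fin n) :
    Executes B extendStep
      { s with left := ((vertexSetCode U).take i).reverse, right := (vertexSetCode U).drop i }
      { s with
        left := ((vertexSetCode (P.greedyExtend G [i] U)).take (i + 1)).reverse
        right := (vertexSetCode (P.greedyExtend G [i] U)).drop (i + 1) } := by
  have hi : i < (vertexSetCode U).length := by simp
  have hU := h.length_vertexSetCode_le U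
  set s₀ : Store M := { s with
    left := ((vertexSetCode U).take i).reverse
    right := (vertexSetCode U).drop (i + 1) }
  have hs₀ : s₀.Ready G T := { hs with }
  refine .pop (.seq (s₁ := { s₀ with cur := vertexSetCode (insert i U) }) ?_ <|
    .seq (.test h hs₀) <| .seq .push (Executes.load.of_eq ?_))
  · rw [vertexSetCode_insert]
    refine .of_eq (.plug hU hi hs.tmp hs.cur ((Executes.pour ?_).of_eq ?_)
      fun y ↦ (Executes.pour ?_).of_eq ?_) ?_
    · simpa [Store.get, Store.set] using (Nat.sub_le _ _).trans h.le
    · simp [Store.get, Store.set, hs.tmp]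
    · simpa [Store.get, Store.set] using i.isLt.le.trans h.le
    · simp [Store.get, Store.set]
    · simp [Store.get, Store.set, s₀]
  · classical
    rw [vertexSetCode_greedyExtend_singleton i (decide_eq_true_iff (p := P.IsSetOf G (insert i U))),
      take_succ_set hi]
    simp [Store.set, Store.get, Control.ext_iff, hs.full, hs.halted, s₀, List.drop_set_of_lt]

theorem Executes.extend (h : Adequate M P G T B) (hs : s.Ready G T) :
    Executes B extend { s with left := [], right := vertexSetCode U } { s with
      left := (vertexSetCode (P.greedyExtend G (List.finRange n) U)).reverse
      right := [] } := by
  set W : ℕ → Set (Fin n) := fun i ↦ P.greedyExtend G ((List.finRange n).take i) U with hW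
  have hstep : ∀ i (hi : i < n), W (i + 1) = P.greedyExtend G [⟨i, hi⟩] (W i) := fun i hi ↦ by
    simp only [hW]
    rw [← GraphClass.greedyExtend_concat, List.take_succ_eq_append_getElem (by simpa using hi),
      List.getElem_finRange]
    rfl
  have htraverse := Traverse.of_forall_getElem (l := s.ones)
    (R := fun _ ↦ Executes B IncrementalEnumeration.extendStep) (I := fun i ↦ { s with
      left := ((vertexSetCode (W i)).take i).reverse
      right := (vertexSetCode (W i)).drop i }) fun i hi ↦ by
    have hi : i < n := by simpa [hs.ones] using hi
    rw [hstep i hi]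
    exact .extendStep h hs ⟨i, hi⟩
  have hn : s.ones.length = n := by simp [hs.ones]
  refine .forEach (l := s.ones) rfl (hn.trans_le h.le) ?_
  rw [hn] at htraverse
  simpa [hW, List.take_of_length_le, List.drop_of_length_le, GraphClass.greedyExtend]
    using htraverse

end

end

/-! ### Reporting a solution -/

section

variable {M : EnumMachine} {B n : ℕ} {s : Store M} {L : List (Set (Fin n))} {E : Set (Fin n)}

/-- The store in which the solutions in `L` have been found and emitted, the last one first. -/
noncomputable def Store.listing (s : Store M) (L : List (Set (Fin n))) : Store M :=
  { s with
    found := separated (L.map vertexSetCode)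
    trace := (L.map vertexSetCode).reverse }

/-- Copy `out` to `cmp`. -/
def copyOut : Procedure M :=
  .seq (pour (.inr .out) (.inr .tmp) id) (move (.inr .tmp) (.inr .cmp) id)

/-- Handle a symbol of the list of solutions in the search for `out`: compare it with the next
symbol of `cmp`, or conclude the comparison with a solution. -/
def compareStep : Option Bool → Procedure M
  | some b => .pop (.inr .cmp) fun o ↦ .load fun c ↦ { c with same := c.same && o == some b }
  | none => .seq (.load fun c ↦ { c with known := c.known || c.same, same := true }) copyOut

/-- Report the set on `out`, whose reversed vector is on `left`, unless it has been reported
before. -/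
def report : Procedure M :=
  .seq copyOut <|
  .seq (.load fun c ↦ { c with same := true }) <|
  .seq (.forEach (.inr .found) compareStep) <|
  .seq (clear (.inr .cmp)) <|
  .seq (.ite (fun c ↦ c.known) skip <| .seq (.push (.inr .found) fun _ ↦ none) <|
    .seq (pour (.inr .left) (.inr .found) some) .emit) <|
  .load fun c ↦ { c with known := false, same := false }

theorem Executes.copyOut (hB : s.out.length ≤ B) (htmp : s.tmp = []) (hcmp : s.cmp = []) :
    Executes B copyOut s { s with cmp := s.out } := by
  refine .seq (.pour hB) ((Executes.move (by simp) ?_).of_eq ?_)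
  · simpa [Store.get, Store.set, htmp] using hB
  · simp [Store.get, Store.set, htmp, hcmp]

theorem traverse_compareStep_word {x y : List Bool} (hxy : x.length = y.length) (hs : s.cmp = y) :
    Traverse (fun o ↦ Executes B (compareStep o)) (x.map some) s { s with
      control := { s.control with same := s.control.same && decide (x = y) }
      cmp := [] } := by
  induction x generalizing y s with
  | nil =>
    obtain rfl : y = [] := List.length_eq_zero_iff.1 hxy.symm
    obtain ⟨⟩ := s
    obtain rfl : _ = [] := hs
    simp [Traverse]
  | cons b x ih =>
    obtain ⟨c, y, rfl⟩ := List.exists_cons_of_length_eq_add_one hxy.symm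
    refine .cons (.pop .load) (.of_eq (ih (by simpa using hxy) (y := y) (by
      simp [Store.set, Store.get, hs])) ?_)
    have hbc : (c == b) = decide (b = c) := by rw [Bool.beq_eq_decide_eq, decide_eq_decide, eq_comm]
    simp [Store.set, Store.get, hs, Bool.and_assoc, hbc]

open Classical in
theorem traverse_compareStep (hn : n ≤ B) (hout : s.out = vertexSetCode E)
    (hcmp : s.cmp = vertexSetCode E) (htmp : s.tmp = []) (hsame : s.control.same = true) :
    Traverse (fun o ↦ Executes B (compareStep o)) (separated (L.map vertexSetCode)) s
      { s with control := { s.control with known := s.control.known || decide (E ∈ L) } } := by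
  induction L generalizing s with
  | nil => simp [Traverse]
  | cons Z L ih =>
    have hZ : decide (vertexSetCode Z = vertexSetCode E) = decide (E = Z) :=
      decide_eq_decide.2 (vertexSetCode_injective.eq_iff.trans eq_comm)
    rw [List.map_cons, separated_cons]
    refine .append (traverse_compareStep_word (by simp) hcmp) <|
      .cons (.seq .load (.copyOut ?_ htmp rfl)) (.of_eq (ih hout hout htmp rfl) ?_)
    · simpa [hout] using hn
    · simp [hsame, hZ, hout, hcmp, Bool.or_assoc]

open Classical in
theorem Executes.report (hn : n ≤ B) (hL : L.length * (n + 1) ≤ B) (htmp : s.tmp = [])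
    (hcmp : s.cmp = []) (hknown : s.control.known = false) (hsame : s.control.same = false) :
    Executes B report
      { s.listing L with
        out := vertexSetCode E
        left := (vertexSetCode E).reverse }
      { s.listing (L.insert E) with
        out := vertexSetCode E
        left := (vertexSetCode E).reverse } := by
  set s₀ : Store M :=
    { s.listing L with out := vertexSetCode E, left := (vertexSetCode E).reverse }
  have hE : (vertexSetCode E).length ≤ B := by simpa using hn
  refine .seq (.copyOut hE htmp hcmp) <| .seq .load <|
    .seq (.forEach (l := separated (L.map vertexSetCode)) rfl ?_
      (traverse_compareStep hn rfl rfl htmp rfl)) <| .seq (.clear hE) <|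
    .seq (s₁ := { s.listing (L.insert E) with
      control := { s.control with known := decide (E ∈ L), same := true }
      out := vertexSetCode E
      left := (vertexSetCode E).reverse })
      (.ite (fun hmem ↦ ?_) fun hmem ↦ ?_) (Executes.load.of_eq ?_)
  · rwa [length_separated (n := n) (by simp), List.length_map]
  · have hmem : E ∈ L := by simpa [Store.set, s₀, Store.listing, hknown] using hmem
    refine Executes.skip.of_eq ?_
    simp [Store.set, s₀, Store.listing, hknown, hmem, hcmp]
  · have hmem : E ∉ L := by simpa [Store.set, s₀, Store.listing, hknown] using hmem
    refine .seq .push (.seq (.pour (List.length_reverse.trans_le hE)) (Executes.emit.of_eq ?_))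
    simp [Store.set, Store.get, s₀, Store.listing, hknown, hmem, hcmp]
  · simp [Store.listing, Control.ext_iff, hknown, hsame]

end

/-! ### Processing a set of vertices -/

section

variable {M : EnumMachine} {P : GraphClass} {B n T : ℕ} {G : SimpleGraph (Fin n)} {s : Store M}
  {L : List (Set (Fin n))} {S : Set (Fin n)}

/-- Translate one position of a vector of an induced subgraph on `tmp` to a position of a vector of
the graph on `left`, where `c` tells whether the vertex belongs to the subgraph. -/
def liftStep (c : Bool) : Procedure M :=
  bif c then .pop (.inr .tmp) fun o ↦ .push (.inr .left) fun _ ↦ o.getD false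
  else .push (.inr .left) fun _ ↦ false

/-- Report the greedy extension of the set of vertices of the subgraph induced by `arg` whose
reversed vector is on `block`. -/
noncomputable def handleBlock : Procedure M :=
  .seq (move (.inr .block) (.inr .tmp) id) <| .seq (.forEach (.inr .arg) liftStep) <|
  .seq (move (.inr .left) (.inr .right) id) <| .seq extend <|
  .seq (pour (.inr .left) (.inr .out) id) <| .seq report <|
  .seq (clear (.inr .left)) (clear (.inr .out))

/-- Handle a symbol of the recorded words. -/
noncomputable def handleStep : Option Bool → Procedure M
  | some b => .push (.inr .block) fun _ ↦ b
  | none => handleBlock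

/-- Run the machine on the subgraph induced by `cur`, and report the greedy extensions of the
solutions that it finds. The flag `solved` tells whether the machine has halted. -/
noncomputable def process : Procedure M :=
  .seq run <| .seq (move (.inr .cur) (.inr .tmp) id) <| .seq (move (.inr .tmp) (.inr .arg) id) <|
  .seq (.load fun c ↦ { c with solved := c.halted, halted := false, full := false }) <|
  .seq (move (.inr .res) (.inr .recorded) id) <| .seq (.forEach (.inr .recorded) handleStep) <|
  .seq (clear (.inr .recorded)) (clear (.inr .arg))

/-- The stacks that `process` uses are empty, except for its argument `cur`. -/
structure Store.Vacant (s : Store M) (G : SimpleGraph (Fin n)) (T : ℕ) : Prop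
    extends s.Ready G T where
  out : s.out = []
  left : s.left = []
  right : s.right = []
  block : s.block = []
  arg : s.arg = []
  recorded : s.recorded = []

theorem traverse_liftStep {xs : List (Fin n)} {c f : Fin n → Bool}
    (h : s.tmp = (xs.filter c).map f) :
    Traverse (fun b ↦ Executes B (liftStep b)) (xs.map c) s { s with
      left := (xs.map fun i ↦ c i && f i).reverse ++ s.left
      tmp := [] } := by
  induction xs generalizing s with
  | nil =>
    obtain ⟨⟩ := s
    obtain rfl : _ = [] := h
    rfl
  | cons x xs ih =>
    refine .cons (s₁ := { s with
      left := (c x && f x) :: s.left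
      tmp := (xs.filter c).map f }) ?_ (.of_eq (ih rfl) (by simp))
    cases hx : c x
    · exact Executes.push.of_eq (by simp [Store.set, Store.get, h, hx])
    · exact .pop (Executes.push.of_eq (by simp [Store.set, Store.get, h, hx]))

theorem map_boolIndicator_and {U : Set (Fin n)} (hU : U ⊆ S) :
    (List.finRange n).map (fun i ↦ S.boolIndicator i && U.boolIndicator i) = vertexSetCode U := by
  rw [vertexSetCode_eq_map_boolIndicator]
  refine List.map_congr_left fun i _ ↦ Bool.eq_iff_iff.2 ?_
  rw [Bool.and_eq_true, ← Set.mem_iff_boolIndicator, ← Set.mem_iff_boolIndicator]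
  exact and_iff_right_of_imp fun hi ↦ hU hi

open Classical in
theorem Executes.handleBlock (h : Adequate M P G T B) (hs : s.Vacant G T)
    (hL : L.length * (n + 1) ≤ B) (r : List (Option Bool))
    (U : Set (Fin (vertexList S).length)) :
    Executes B handleBlock
      { s.listing L with
        arg := vertexSetCode S
        recorded := r
        block := (vertexSetCode U).reverse }
      { s.listing (L.insert (P.greedyExtend G (List.finRange n) (vertexEnum S '' U))) with
        arg := vertexSetCode S
        recorded := r } := by
  set W := vertexEnum S '' U
  set E := P.greedyExtend G (List.finRange n) W
  set s₀ : Store M := { s with arg := vertexSetCode S, recorded := r }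
  have hs₀ : (s₀.listing L).Ready G T := { hs with }
  have hW := h.length_vertexSetCode_le W
  have hE := h.length_vertexSetCode_le E
  refine .seq (s₁ := { s₀.listing L with tmp := vertexSetCode U }) ?_ <|
    .seq (s₁ := { s₀.listing L with left := (vertexSetCode W).reverse }) ?_ <|
    .seq (s₁ := { s₀.listing L with left := [], right := vertexSetCode W }) ?_ <|
    .seq (.extend h hs₀) <|
    .seq (s₁ := { s₀.listing L with
      out := vertexSetCode E
      left := (vertexSetCode E).reverse }) ?_ <|
    .seq (.report h.le hL hs.tmp hs.cmp hs.known hs.same) <|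
    .seq (.clear (by simpa [Store.get] using hE)) ((Executes.clear hE).of_eq ?_)
  · refine (Executes.move (by simp) ?_).of_eq ?_
    · simpa [Store.get] using (length_vertexList_le S).trans h.le
    · simp [Store.set, Store.get, Store.listing, s₀, hs.tmp, hs.block]
  · refine .forEach (vertexSetCode_eq_map_boolIndicator S) (by simpa using h.le)
      (.of_eq (traverse_liftStep (vertexSetCode_eq_map_vertexList U)) ?_)
    simp [map_boolIndicator_and (image_vertexEnum_subset U), Store.listing, s₀, hs.left, hs.tmp, W]
  · refine (Executes.move (by simp) ?_).of_eq ?_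
    · simpa [Store.get] using hW
    · simp [Store.set, Store.get, Store.listing, s₀, hs.right]
  · refine (Executes.pour ?_).of_eq ?_
    · simpa [Store.get] using hE
    · simp [Store.set, Store.get, Store.listing, s₀, hs.right, hs.out, E]
  · simp [Store.set, Store.listing, s₀, hs.left, hs.out]

theorem traverse_handleStep_word {x : List Bool} :
    Traverse (fun o ↦ Executes B (handleStep o)) (x.map some) s
      { s with block := x.reverse ++ s.block } := by
  induction x generalizing s with
  | nil => rfl
  | cons b x ih => exact .cons .push (.of_eq ih (by simp [Store.set, Store.get]))

open Classical in
theorem traverse_handleStep (h : Adequate M P G T B) (hs : s.Vacant G T)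
    {Us : List (Set (Fin (vertexList S).length))} (hL : (L.length + Us.length) * (n + 1) ≤ B)
    (r : List (Option Bool)) :
    Traverse (fun o ↦ Executes B (handleStep o)) (separated (Us.map vertexSetCode))
      { s.listing L with arg := vertexSetCode S, recorded := r }
      { s.listing (P.insertExtensions G (List.finRange n) L (Us.map (vertexEnum S '' ·))) with
        arg := vertexSetCode S
        recorded := r } := by
  induction Us generalizing L with
  | nil => rfl
  | cons U Us ih =>
    rw [List.map_cons, separated_cons]
    refine .append (traverse_handleStep_word.of_eq ?_) (.cons (.handleBlock h hs ?_ r U) (ih ?_))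
    · simp [Store.listing, hs.block]
    · exact (Nat.mul_le_mul_right _ (Nat.le_add_right _ _)).trans hL
    · refine (Nat.mul_le_mul_right _ ?_).trans hL
      grind [List.length_insert]

open Classical in
theorem Executes.process (h : Adequate M P G T B) (hs : s.Vacant G T)
    {Us : List (Set (Fin (vertexList S).length))}
    (hUs : M.outputs (graphCode (inducedGraph G S)) T = Us.map vertexSetCode)
    (hL : (L.length + (T + 1)) * (n + 1) ≤ B) :
    Executes B process { s.listing L with cur := vertexSetCode S }
      { s.listing (P.insertExtensions G (List.finRange n) L (Us.map (vertexEnum S '' ·))) with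
        control := { s.control with solved := decide (HaltsOn M G T S) } } := by
  set L' := P.insertExtensions G (List.finRange n) L (Us.map (vertexEnum S '' ·))
  set r := separated (Us.map vertexSetCode)
  have hs₀ : (s.listing L).Ready G T := { hs with }
  have hrun := Executes.run_of_ready (S := S) h hs₀
  have hrB := h.length_separated_outputs_le S
  rw [hUs] at hrun hrB
  set s' : Store M := { s with control := { s.control with solved := decide (HaltsOn M G T S) } }
  have hs' : s'.Vacant G T := { hs with }
  have hS := h.length_vertexSetCode_le S
  refine .seq hrun <| .seq (.move (by simp) hS) <|
    .seq (.move (by simp) (by simpa [Store.get, Store.set, Store.listing, hs.tmp] using hS)) <|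
    .seq .load <|
    .seq (s₁ := { s'.listing L with arg := vertexSetCode S, recorded := r })
      ((Executes.move (by simp) (by simpa [Store.get, Store.set] using hrB)).of_eq ?_) <|
    .seq (s₁ := { s'.listing L' with arg := vertexSetCode S, recorded := r })
      (.forEach rfl hrB ?_) <|
    .seq (.clear hrB) ((Executes.clear hS).of_eq ?_)
  · simp [Store.set, Store.get, Store.listing, s', hs.tmp, hs.arg, hs.recorded, hs.full,
      hs.halted, hs.cur, hs.res, r]
  · refine traverse_handleStep h hs'
      ((Nat.mul_le_mul_right _ (Nat.add_le_add_left ?_ L.length)).trans hL) r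
    simpa [hUs] using M.length_outputs_le (graphCode (inducedGraph G S)) T
  · simp [Store.set, Store.listing, s', hs.arg, hs.recorded]

open Classical in
theorem exists_executes_process (hP : P.Hereditary) (h : Adequate M P G T B) (hs : s.Vacant G T)
    (hL : P.ListsSolutions G L) (hB : (L.length + (T + 1)) * (n + 1) ≤ B) (S : Set (Fin n)) :
    ∃ L', Executes B process { s.listing L with cur := vertexSetCode S } { s.listing L' with
        control := { s.control with solved := decide (HaltsOn M G T S) } } ∧
      P.ListsSolutions G L' ∧ L ⊆ L' ∧ L'.length ≤ L.length + (T + 1) ∧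
      (HaltsOn M G T S → P.Covers G {Z | Z ∈ L'} S) := by
  obtain ⟨t, ht⟩ := h.enumeratesWithin S
  obtain ⟨Us, hUs, hmax⟩ := ht.exists_outputs_eq_map T
  refine ⟨_, .process h hs hUs hB, hL.insertExtensions hP (List.mem_finRange ·) ?_,
    GraphClass.subset_insertExtensions, GraphClass.length_insertExtensions_le.trans ?_,
    fun hT ↦ ?_⟩
  · simp only [List.mem_map]
    rintro _ ⟨U, hU, rfl⟩
    exact GraphClass.isSetOf_inducedGraph.1 (hmax U hU).1
  · simpa [hUs] using M.length_outputs_le (graphCode (inducedGraph G S)) T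
  · refine (GraphClass.covers_range (vertexEnum_injective S) fun U hU ↦ ?_).mono
      subset_rfl (range_vertexEnum S).superset
    have hmem := (ht.mem_outputs_iff hT).2 ⟨U, hU, rfl⟩
    rw [hUs, List.mem_map_of_injective vertexSetCode_injective] at hmem
    exact GraphClass.exists_subset_of_mem_insertExtensions (List.mem_map_of_mem hmem)

end

/-! ### Shrinking to a minimal hard set -/

section

variable {M : EnumMachine} {P : GraphClass} {B n T : ℕ} {G : SimpleGraph (Fin n)} {s : Store M}
  {L L' : List (Set (Fin n))} {K : Set (Fin n)}

/-- The state of the greedy search for a minimal set `K` of vertices on which `M` does not halt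
within `T` steps, after the first `i` vertices have been tried. -/
structure ShrinkInvariant (M : EnumMachine) (P : GraphClass) (G : SimpleGraph (Fin n)) (T : ℕ)
    (L : List (Set (Fin n))) (i : ℕ) (K : Set (Fin n)) : Prop where
  not_haltsOn : ¬HaltsOn M G T K
  mem : ∀ v : Fin n, i ≤ v → v ∈ K
  covers : ∀ v ∈ K, (v : ℕ) < i → P.Covers G {Z | Z ∈ L} (K \ {v})

namespace ShrinkInvariant

theorem succ_of_haltsOn {i : Fin n} (h : ShrinkInvariant M P G T L i K) (hL : L ⊆ L')
    (hcov : P.Covers G {Z | Z ∈ L'} (K \ {i})) : ShrinkInvariant M P G T L' (i + 1) K where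
  not_haltsOn := h.not_haltsOn
  mem v hv := h.mem v (Nat.le_of_succ_le hv)
  covers v hv hvi := by
    rcases Nat.lt_succ_iff_lt_or_eq.1 hvi with hvi | hvi
    · exact (h.covers v hv hvi).mono (fun _ hZ ↦ hL hZ) subset_rfl
    · rwa [Fin.ext hvi]

theorem succ_of_not_haltsOn {i : Fin n} (h : ShrinkInvariant M P G T L i K) (hL : L ⊆ L')
    (hi : ¬HaltsOn M G T (K \ {i})) : ShrinkInvariant M P G T L' (i + 1) (K \ {i}) where
  not_haltsOn := hi
  mem v hv := ⟨h.mem v (Nat.le_of_succ_le hv), fun hvi ↦ by simp_all⟩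
  covers v hv hvi := by
    have hvi : (v : ℕ) < i := lt_of_le_of_ne (Nat.le_of_lt_succ hvi) fun he ↦ hv.2 (Fin.ext he)
    exact (h.covers v hv.1 hvi).mono (fun _ hZ ↦ hL hZ)
      (Set.sdiff_subset_sdiff_left Set.sdiff_subset)

theorem numSolutions_le (h : ShrinkInvariant M P G T L n K) (hP : P.Hereditary)
    (hM : Adequate M P G T B) (hL : P.ListsSolutions G L) :
    P.numSolutions (inducedGraph G K) ≤ L.length := by
  have hcard : {Z | Z ∈ L}.ncard ≤ L.length := by
    classical
    rw [← List.coe_toFinset, Set.ncard_coe_finset]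
    exact L.toFinset_card_le
  refine (hP.numSolutions_comap_le (vertexEnum_injective K)
    (fun Z hZ ↦ (hL.isMaximalSetOf Z hZ).1) ?_ fun v ↦ ?_).trans hcard
  · rw [range_vertexEnum]
    exact fun hK ↦ h.not_haltsOn (hM.haltsOn K hK)
  · have hv : vertexEnum K v ∈ K := (range_vertexEnum K).subset (Set.mem_range_self v)
    rw [range_vertexEnum]
    exact h.covers _ hv (Fin.isLt _)

end ShrinkInvariant

/-- Remove the current vertex from the set on the zipper `outerLeft`, `outerRight`, unless the
machine halts on the smaller set, and proceed to the next vertex. -/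
noncomputable def shrinkStep : Procedure M :=
  .pop (.inr .outerRight) fun _ ↦
    .seq (plug false (pour (.inr .outerRight) (.inr .tmp) id)
      (pour (.inr .outerLeft) (.inr .cur) id)) <|
    .seq process <| .seq (.push (.inr .outerLeft) fun c ↦ c.solved)
      (.load fun c ↦ { c with solved := false })

/-- Shrink the set of all vertices to a minimal set on which the machine does not halt. -/
noncomputable def shrink : Procedure M :=
  .seq (pour (.inr .ones) (.inr .outerRight) id) <|
  .seq (.forEach (.inr .ones) fun _ ↦ shrinkStep) (clear (.inr .outerLeft))

/-- Treat the set of all vertices. If the machine does not halt within the step budget, then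
process its subsets during the search for a minimal hard set, and increase the step budget. -/
noncomputable def stage : Procedure M :=
  .seq (pour (.inr .ones) (.inr .cur) id) <| .seq process <|
  .ite (fun c ↦ c.solved) (.load fun c ↦ { c with solved := false, finished := true }) <|
  .seq shrink (.push (.inr .budget) fun _ ↦ true)

/-- The store is in order between two stages with the step budget `T`. -/
structure Store.Resting (s : Store M) (G : SimpleGraph (Fin n)) (T : ℕ) : Prop
    extends s.Vacant G T where
  outerLeft : s.outerLeft = []
  outerRight : s.outerRight = []
  solved : s.control.solved = false

/-- The store in which the first `i` vertices have been tried and the current set is `K`. -/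
noncomputable def Store.shrinking (s : Store M) (L : List (Set (Fin n))) (i : ℕ)
    (K : Set (Fin n)) : Store M :=
  { s.listing L with
    outerLeft := ((vertexSetCode K).take i).reverse
    outerRight := (vertexSetCode K).drop i }

theorem exists_executes_shrinkStep (hP : P.Hereditary) (h : Adequate M P G T B)
    (hs : s.Resting G T) (hL : P.ListsSolutions G L) (hB : (L.length + (T + 1)) * (n + 1) ≤ B)
    {i : Fin n} (hK : ShrinkInvariant M P G T L i K) :
    ∃ L' K', Executes B shrinkStep (s.shrinking L i K) (s.shrinking L' (i + 1) K') ∧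
      ShrinkInvariant M P G T L' (i + 1) K' ∧ P.ListsSolutions G L' ∧
      L'.length ≤ L.length + (T + 1) := by
  classical
  have hi : i < (vertexSetCode K).length := by simp
  set s₀ : Store M := { s with
    outerLeft := ((vertexSetCode K).take i).reverse
    outerRight := (vertexSetCode K).drop (i + 1) }
  have hs₀ : s₀.Vacant G T := { hs with }
  obtain ⟨L', hexec, hL', hsub, hlen, hcov⟩ :=
    exists_executes_process hP h hs₀ hL hB (K \ {i})
  have hstep : Executes B shrinkStep (s.shrinking L i K) { s.listing L' with
      outerLeft := decide (HaltsOn M G T (K \ {i})) :: ((vertexSetCode K).take i).reverse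
      outerRight := (vertexSetCode K).drop (i + 1) } := by
    refine .pop (.seq (.of_eq (.plug (h.length_vertexSetCode_le K) hi hs.tmp hs.cur
      ((Executes.pour ?_).of_eq ?_) fun y ↦ (Executes.pour ?_).of_eq ?_) ?_) <|
      .seq hexec <| .seq .push (Executes.load.of_eq ?_))
    · simpa [Store.get, Store.set, Store.shrinking] using (Nat.sub_le _ _).trans h.le
    · simp [Store.get, Store.set, Store.shrinking, Store.listing, hs.tmp]
    · simpa [Store.get, Store.set, Store.shrinking] using i.isLt.le.trans h.le
    · simp [Store.get, Store.set, Store.shrinking]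
    · simp [Store.get, Store.set, Store.shrinking, Store.listing, s₀, vertexSetCode_sdiff_singleton]
    · simp [Store.get, Store.set, Store.listing, s₀, Control.ext_iff, hs.solved]
  have hset : ∀ b, { s.listing L' with
      outerLeft := b :: ((vertexSetCode K).take i).reverse
      outerRight := (vertexSetCode K).drop (i + 1) } = { s.listing L' with
      outerLeft := (((vertexSetCode K).set i b).take (i + 1)).reverse
      outerRight := ((vertexSetCode K).set i b).drop (i + 1) } := fun b ↦ by
    simp [take_succ_set hi, List.drop_set_of_lt]
  rw [hset] at hstep
  by_cases hhalt : HaltsOn M G T (K \ {i})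
  · refine ⟨L', K, hstep.of_eq ?_, hK.succ_of_haltsOn hsub (hcov hhalt), hL', hlen⟩
    have hiK : K.boolIndicator i = true := (K.mem_iff_boolIndicator i).1 (hK.mem i le_rfl)
    rw [decide_eq_true hhalt, ← hiK, ← getElem_vertexSetCode K hi, List.set_getElem_self]
    rfl
  · refine ⟨L', K \ {i}, hstep.of_eq ?_, hK.succ_of_not_haltsOn hsub hhalt, hL', hlen⟩
    rw [decide_eq_false hhalt, ← vertexSetCode_sdiff_singleton]
    rfl

theorem exists_executes_shrink (hP : P.Hereditary) (h : Adequate M P G T B)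
    (hs : s.Resting G T) (hL : P.ListsSolutions G L)
    (hB : (L.length + n * (T + 1)) * (n + 1) ≤ B) (huniv : ¬HaltsOn M G T Set.univ) :
    ∃ L' K, Executes B shrink (s.listing L) (s.listing L') ∧ P.ListsSolutions G L' ∧
      L'.length ≤ L.length + n * (T + 1) ∧ ¬HaltsOn M G T K ∧
      P.numSolutions (inducedGraph G K) ≤ L'.length := by
  have hn : s.ones.length = n := by simp [hs.ones]
  obtain ⟨s', hloop, K, L', rfl, hK, hL', hlen⟩ := Traverse.exists_of_forall_getElem
    (l := s.ones) (s := s.shrinking L 0 Set.univ) (R := fun _ ↦ Executes B shrinkStep)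
    (I := fun i s' ↦ ∃ K L', s' = s.shrinking L' i K ∧ ShrinkInvariant M P G T L' i K ∧
      P.ListsSolutions G L' ∧ L'.length ≤ L.length + i * (T + 1))
    ⟨Set.univ, L, rfl, ⟨huniv, fun _ _ ↦ trivial, by simp⟩, hL, by simp⟩ <| by
      rintro i hi _ ⟨K, L', rfl, hK, hL', hlen⟩
      rw [hn] at hi
      have hlen_succ : L'.length + (T + 1) ≤ L.length + (i + 1) * (T + 1) := by linarith
      obtain ⟨L'', K', hexec, hK', hL'', hlen'⟩ := exists_executes_shrinkStep (i := ⟨i, hi⟩) hP h hs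
        hL' ((Nat.mul_le_mul_right _ (hlen_succ.trans (by gcongr; exact hi))).trans hB) hK
      exact ⟨_, hexec, K', L'', rfl, hK', hL'', hlen'.trans hlen_succ⟩
  rw [hn] at hK hlen hloop
  refine ⟨L', K, .seq (s₁ := s.shrinking L 0 Set.univ) ((Executes.pour ?_).of_eq ?_) <|
    .seq (.forEach rfl ?_ hloop) ((Executes.clear ?_).of_eq ?_), hL', hlen,
    hK.not_haltsOn, hK.numSolutions_le hP h hL'⟩
  · exact hn.trans_le h.le
  · simp [Store.get, Store.set, Store.listing, Store.shrinking, hs.ones, hs.outerLeft,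
      hs.outerRight, vertexSetCode_univ]
  · exact hn.trans_le h.le
  · simpa [Store.get, Store.shrinking] using h.le
  · simp [Store.set, Store.listing, Store.shrinking, hs.outerLeft, hs.outerRight,
      List.drop_of_length_le]

theorem exists_executes_stage (hP : P.Hereditary) (h : Adequate M P G T B)
    (hs : s.Resting G T) (hL : P.ListsSolutions G L)
    (hB : (L.length + (n + 1) * (T + 1)) * (n + 1) ≤ B) :
    ∃ L', P.ListsSolutions G L' ∧ L'.length ≤ L.length + (n + 1) * (T + 1) ∧
      ((Executes B stage (s.listing L)
          { s.listing L' with control := { s.control with finished := true } } ∧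
        P.Covers G {Z | Z ∈ L'} Set.univ) ∨
      (Executes B stage (s.listing L) { s.listing L' with budget := true :: s.budget } ∧
        ∃ K, ¬HaltsOn M G T K ∧ P.numSolutions (inducedGraph G K) ≤ L'.length)) := by
  classical
  have hsum : L.length + (n + 1) * (T + 1) = L.length + (T + 1) + n * (T + 1) := by ring
  rw [hsum] at hB ⊢
  obtain ⟨L₁, hexec, hL₁, -, hlen, hcov⟩ := exists_executes_process hP h hs.toVacant hL
    ((Nat.mul_le_mul_right _ (Nat.le_add_right _ _)).trans hB) Set.univ
  have hones : Executes B (pour (.inr .ones) (.inr .cur) id) (s.listing L)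
      { s.listing L with cur := vertexSetCode (Set.univ : Set (Fin n)) } := by
    refine (Executes.pour ?_).of_eq ?_
    · simpa [Store.get, Store.listing, hs.ones] using h.le
    · simp [Store.get, Store.set, Store.listing, hs.ones, hs.cur, vertexSetCode_univ]
  by_cases huniv : HaltsOn M G T Set.univ
  · refine ⟨L₁, hL₁, hlen.trans (Nat.le_add_right _ _), .inl ⟨?_, hcov huniv⟩⟩
    refine .seq hones <| .seq hexec <| .ite (fun _ ↦ Executes.load.of_eq ?_) fun hf ↦ ?_
    · simp [Store.listing, hs.solved]
    · simp [huniv] at hf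
  · obtain ⟨L', K, hshrink, hL', hlen', hK, hnum⟩ := exists_executes_shrink hP h hs hL₁
      ((Nat.mul_le_mul_right _ (Nat.add_le_add_right hlen _)).trans hB) huniv
    refine ⟨L', hL', hlen'.trans (Nat.add_le_add_right hlen _), .inr ⟨?_, K, hK, hnum⟩⟩
    refine .seq hones <| .seq (hexec.of_eq ?_) <| .ite (fun hf ↦ ?_) fun _ ↦ .seq hshrink .push
    · simp [Store.listing, Control.ext_iff, hs.solved, huniv]
    · simp [Store.listing, hs.solved] at hf

end

/-! ### Initialization -/

section

variable {M : EnumMachine} {B n : ℕ} {G : SimpleGraph (Fin n)} {s : Store M}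

/-- Execute a program `k` times. -/
def repeated (p : Procedure M) : ℕ → Procedure M
  | 0 => skip
  | k + 1 => .seq (repeated p k) p

theorem Executes.repeated {p : Procedure M} {k : ℕ} {I : ℕ → Store M}
    (h : ∀ i < k, Executes B p (I i) (I (i + 1))) : Executes B (repeated p k) (I 0) (I k) := by
  induction k with
  | zero => exact .skip
  | succ k ih => exact .seq (ih fun i hi ↦ h i (hi.trans k.lt_succ_self)) (h k k.lt_succ_self)

/-- Push an entry on `ones` for every row of the adjacency matrix. -/
def countRows : Procedure M :=
  .forEach (.inr .inp) fun o ↦ o.elim (.push (.inr .ones) fun _ ↦ true) fun _ ↦ skip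

/-- Multiply the step budget by the number of vertices plus one. -/
def multiply : Procedure M :=
  .seq (.forEach (.inr .budget) fun _ ↦
    .seq (pour (.inr .ones) (.inr .tmp) id) (.push (.inr .tmp) fun _ ↦ true)) <|
  .seq (clear (.inr .budget)) (move (.inr .tmp) (.inr .budget) id)

/-- Compute the number `n` of vertices, and set the step budget to `C * (n + 1) ^ k`. -/
def prepare (C k : ℕ) : Procedure M :=
  .seq countRows <| .seq (repeated (.push (.inr .budget) fun _ ↦ true) C) (repeated multiply k)

theorem count_none_graphCode (G : SimpleGraph (Fin n)) : (graphCode G).count none = n := by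
  have hrow (f : Fin n → Bool) : ((List.finRange n).map fun j ↦ some (f j)).count none = 0 :=
    List.count_eq_zero.2 (by simp)
  simp [graphCode, List.count_flatMap, Function.comp_def, hrow]

theorem Executes.countRows {w : List (Option Bool)} (hw : s.inp = w) (hB : w.length ≤ B) :
    Executes B countRows s { s with ones := List.replicate (w.count none) true ++ s.ones } := by
  refine .forEach hw hB ?_
  clear hw hB
  induction w generalizing s with
  | nil => rfl
  | cons o w ih =>
    rcases o with _ | b
    · exact .cons .push (.of_eq ih (by simp [Store.set, Store.get, List.replicate_succ']))
    · exact .cons .skip (.of_eq ih (by simp))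

theorem Executes.multiply {T : ℕ} (hones : s.ones = List.replicate n true) (htmp : s.tmp = [])
    (hn : n ≤ B) (hB : T * (n + 1) ≤ B) :
    Executes B multiply { s with budget := List.replicate T true }
      { s with budget := List.replicate (T * (n + 1)) true } := by
  have hT : (List.replicate T true).length ≤ B := by
    simpa using (Nat.le_mul_of_pos_right T n.succ_pos).trans hB
  set s' : Store M := { s with budget := List.replicate T true }
  have hloop := Traverse.of_forall_getElem (l := List.replicate T true)
    (R := fun _ ↦ Executes B (.seq (IncrementalEnumeration.pour (.inr .ones) (.inr .tmp) id)
      (.push (.inr .tmp) fun _ ↦ true)))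
    (I := fun i ↦ { s' with tmp := List.replicate (i * (n + 1)) true }) fun i _ ↦ by
      refine .seq (.pour (by simpa [Store.get, s', hones] using hn)) (Executes.push.of_eq ?_)
      have hi : (i + 1) * (n + 1) = n + i * (n + 1) + 1 := by ring
      simp [Store.get, Store.set, s', hones, hi, List.replicate_succ]
  rw [Nat.zero_mul, List.length_replicate] at hloop
  refine .seq (s₁ := { s' with tmp := List.replicate (T * (n + 1)) true })
    (.forEach (l := List.replicate T true) rfl hT ?_) <|
    .seq (.clear hT) ((Executes.move (by simp) ?_).of_eq ?_)
  · simpa [s', htmp] using hloop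
  · simpa [Store.get, Store.set] using hB
  · simp [Store.get, Store.set, s', htmp]

theorem Executes.prepare {C k : ℕ} (hinp : s.inp = graphCode G) (hones : s.ones = [])
    (hbudget : s.budget = []) (htmp : s.tmp = []) (hn : n * (n + 1) ≤ B)
    (hB : C * (n + 1) ^ k ≤ B) :
    Executes B (prepare C k) s { s with
      ones := List.replicate n true
      budget := List.replicate (C * (n + 1) ^ k) true } := by
  set s' : Store M := { s with ones := List.replicate n true }
  have hpush := Executes.repeated (B := B) (p := .push (.inr .budget) fun _ ↦ true) (k := C)
    (I := fun i ↦ { s' with budget := List.replicate i true }) fun i _ ↦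
      Executes.push.of_eq (by simp [Store.get, Store.set, List.replicate_succ])
  have hmultiply := Executes.repeated (B := B) (p := IncrementalEnumeration.multiply) (k := k)
    (I := fun i ↦ { s' with budget := List.replicate (C * (n + 1) ^ i) true }) fun i hi ↦ by
      have hi : C * (n + 1) ^ i * (n + 1) ≤ B := by
        rw [mul_assoc, ← pow_succ]
        exact (Nat.mul_le_mul_left C (Nat.pow_le_pow_right n.succ_pos hi)).trans hB
      rw [pow_succ, ← mul_assoc]
      exact .multiply rfl htmp ((Nat.le_mul_of_pos_right n n.succ_pos).trans hn) hi
  rw [pow_zero, mul_one] at hmultiply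
  refine .seq ((Executes.countRows hinp ?_).of_eq ?_) <| .seq hpush hmultiply
  · rwa [length_graphCode]
  · simp [count_none_graphCode, hones, hbudget, s']

end

/-! ### The incremental enumeration program -/

variable {M : EnumMachine} {P : GraphClass} {p : MvPolynomial (Fin 2) ℕ}
  {B C J k n t T : ℕ} {G : SimpleGraph (Fin n)} {L : List (Set (Fin n))}

instance (M : EnumMachine) : Fintype M.K := M.kFin

noncomputable instance (M : EnumMachine) : Fintype (Control M) := .ofFinite _

noncomputable instance (M : EnumMachine) : ∀ k, Fintype (Alphabet M k)
  | .inl k => have := M.finite_alphabet k; .ofFinite _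
  | .inr k => inferInstanceAs (Fintype k.Alphabet)

/-- The initial value of the finite memory. -/
def Control.initial (M : EnumMachine) : Control M where
  label := none
  var := M.initialState
  allTrue := true
  full := false
  halted := false
  solved := false
  known := false
  same := false
  finished := false

/-- The initial store on the input graph `G`. -/
noncomputable def Store.initial (M : EnumMachine) (G : SimpleGraph (Fin n)) : Store M where
  control := .initial M
  simulated _ := []
  inp := graphCode G
  out := []
  budget := []
  ones := []
  cur := []
  word := []
  copy := []
  res := []
  recorded := []
  block := []
  arg := []
  left := []
  right := []
  outerLeft := []
  outerRight := []
  cmp := []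
  tmp := []
  found := []
  trace := []

/-- The store before a stage with step budget `T`, apart from the solutions found so far. -/
noncomputable def Store.resting (M : EnumMachine) (G : SimpleGraph (Fin n)) (T : ℕ) : Store M :=
  { Store.initial M G with ones := List.replicate n true, budget := List.replicate T true }

theorem Store.resting_resting (M : EnumMachine) (G : SimpleGraph (Fin n)) (T : ℕ) :
    (Store.resting M G T).Resting G T := by
  repeat' constructor

/-- The program that performs stages with increasing step budgets, starting with
`C * (n + 1) ^ k`. -/
noncomputable def program (M : EnumMachine) (C k : ℕ) :
    LoopProgram (Alphabet M) (Control M) where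
  toPorts := ports M
  initial := .initial M
  init := prepare C k
  body := stage
  done c := c.finished

theorem toState_initial (M : EnumMachine) (C k : ℕ) (G : SimpleGraph (Fin n)) :
    (Store.initial M G).toState = (program M C k).start (graphCode G) := by
  refine State.ext rfl (funext fun i ↦ ?_) rfl
  rcases i with i | i
  · rfl
  · cases i with
    | inp => exact (List.map_id (graphCode G)).symm
    | _ => rfl

/-- After `t` steps the program is about to perform a stage with step budget `T`, and `L` is the
list of the solutions found so far, the last one first. -/
structure AtStage (M : EnumMachine) (P : GraphClass) (C k : ℕ) (G : SimpleGraph (Fin n)) (t T : ℕ)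
    (L : List (Set (Fin n))) : Prop where
  listsSolutions : P.ListsSolutions G L
  atHead : (program M C k).AtHead (graphCode G) t ((Store.resting M G T).listing L).toState

theorem exists_atStage (hn : n * (n + 1) ≤ B) (hB : C * (n + 1) ^ k ≤ B) :
    ∃ t ≤ cost B (prepare C k : Procedure M), AtStage M P C k G t (C * (n + 1) ^ k) [] := by
  have hprepare : Executes B (prepare C k) (Store.initial M G)
      ((Store.resting M G (C * (n + 1) ^ k)).listing ([] : List (Set (Fin n)))) :=
    .prepare rfl rfl rfl rfl hn hB
  rw [Executes, toState_initial M C k] at hprepare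
  obtain ⟨t, ht, hhead⟩ := LoopProgram.exists_atHead_of_init (A := program M C k) hprepare
  exact ⟨t, ht, ⟨List.nodup_nil, by simp⟩, hhead⟩

namespace AtStage

theorem length_outputs (h : AtStage M P C k G t T L) :
    ((program M C k).machine.outputs (graphCode G) t).length = L.length := by
  obtain ⟨-, -, -, houtputs⟩ := h
  rw [houtputs]
  simp [Store.toState, Store.listing]

theorem step (h : AtStage M P C k G t T L) (hP : P.Hereditary) (hA : Adequate M P G T B)
    (hB : (L.length + (n + 1) * (T + 1)) * (n + 1) ≤ B) :
    ∃ t' ≤ t + (cost B (stage : Procedure M) + 1),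
      (program M C k).machine.EnumeratesWithin P G (t' + 1) ∨
      ∃ L', AtStage M P C k G t' (T + 1) L' ∧ L'.length ≤ L.length + (n + 1) * (T + 1) ∧
        ∃ K, ¬HaltsOn M G T K ∧ P.numSolutions (inducedGraph G K) ≤ L'.length := by
  obtain ⟨L', hL', hlen, ⟨hstage, hcov⟩ | ⟨hstage, hK⟩⟩ :=
    exists_executes_stage hP hA (Store.resting_resting M G T) h.listsSolutions hB
  · obtain ⟨t', ht', hhead⟩ := h.atHead.step rfl hstage
    obtain ⟨hhalt, houtputs⟩ := hhead.halted rfl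
    refine ⟨t', ht', .inl ⟨hhalt, ?_⟩⟩
    replace houtputs : _ = (L'.map vertexSetCode).reverse := houtputs
    rw [houtputs, List.nodup_reverse]
    refine ⟨hL'.nodup.map vertexSetCode_injective, fun x ↦ ?_⟩
    simp only [List.mem_reverse, List.mem_map, hL'.mem_iff hcov]
  · obtain ⟨t', ht', hhead⟩ := h.atHead.step rfl hstage
    exact ⟨t', ht', .inr ⟨L', ⟨hL', hhead⟩, hlen, hK⟩⟩

end AtStage

/-- A bound for the lengths of all loops in the first `J + 1` stages, if the step budget is at most
`T` in them. -/
def loopBound (M : EnumMachine) (n T J : ℕ) : ℕ :=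
  n * (n + 1) + T * M.growth + (J + 1) * ((n + 1) * (T + 1)) * (n + 1)

theorem loopBound_mono {T' J' : ℕ} (hT : T ≤ T') (hJ : J ≤ J') :
    loopBound M n T J ≤ loopBound M n T' J' := by
  unfold loopBound
  gcongr

theorem AtStage.exists_of_le {t₀ : ℕ} (h : AtStage M P C k G t₀ T []) (hP : P.Hereditary)
    (hA : ∀ j ≤ J, Adequate M P G (T + j) B) (hB : loopBound M n (T + J) J ≤ B) :
    ∀ j ≤ J, ∃ t ≤ t₀ + j * (cost B (stage : Procedure M) + 1),
      (program M C k).machine.EnumeratesWithin P G (t + 1) ∨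
      ∃ L, AtStage M P C k G t (T + j) L ∧ L.length ≤ j * ((n + 1) * (T + J + 1)) := by
  intro j hj
  induction j with
  | zero => exact ⟨t₀, by simp, .inr ⟨[], h, by simp⟩⟩
  | succ j ih =>
    obtain ⟨t, ht, hdone | ⟨L, hstage, hlen⟩⟩ := ih (by omega)
    · exact ⟨t, ht.trans (by gcongr; omega), .inl hdone⟩
    have hsucc : L.length + (n + 1) * (T + j + 1) ≤ (j + 1) * ((n + 1) * (T + J + 1)) := by
      rw [Nat.succ_mul j]
      gcongr
      omega
    obtain ⟨t', ht', hdone | ⟨L', hstage', hlen', -⟩⟩ := hstage.step hP (hA j (by omega)) <|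
      calc (L.length + (n + 1) * (T + j + 1)) * (n + 1)
        _ ≤ (J + 1) * ((n + 1) * (T + J + 1)) * (n + 1) := by
          gcongr
          exact hsucc.trans (by gcongr; omega)
        _ ≤ B := (Nat.le_add_left _ _).trans hB
    · exact ⟨t', by rw [Nat.succ_mul]; omega, .inl hdone⟩
    · exact ⟨t', by rw [Nat.succ_mul]; omega, .inr ⟨L', hstage', hlen'.trans hsucc⟩⟩

/-- A bound for the duration of the first `J + 1` stages. -/
noncomputable def timeBound (M : EnumMachine) (C k n J : ℕ) : ℕ :=
  let B := loopBound M n (C * (n + 1) ^ k + J) J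
  cost B (prepare C k : Procedure M) + (J + 1) * (cost B (stage : Procedure M) + 1) + 1

theorem isPolynomial_timeBound {f : ℕ → ℕ → ℕ} (hf : IsPolynomial f) :
    IsPolynomial fun n s ↦ timeBound M C k n (f n s) := by
  have hn : IsPolynomial fun n _ ↦ n + 1 := .add .fst (.const 1)
  have hT : IsPolynomial fun n s ↦ C * (n + 1) ^ k + f n s := .add (.mul (.const C) (hn.pow k)) hf
  have hJ : IsPolynomial fun n s ↦ f n s + 1 := hf.add (.const 1)
  have hB : IsPolynomial fun n s ↦ loopBound M n (C * (n + 1) ^ k + f n s) (f n s) :=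
    .add (.add (.mul .fst hn) (hT.mul (.const _)))
      (.mul (hJ.mul (hn.mul (hT.add (.const 1)))) hn)
  exact .add (.add (hB.cost _) (hJ.mul (.add (hB.cost _) (.const 1)))) (.const 1)

section

variable (hM : ∀ (n : ℕ) (G : SimpleGraph (Fin n)),
    M.EnumeratesWithin P G (MvPolynomial.eval ![n, P.numSolutions G] p))
  (hC : ∀ m n, m ≤ n → MvPolynomial.eval ![m, 1] p ≤ C * (n + 1) ^ k)

include hM

theorem lt_eval_of_not_haltsOn {K : Set (Fin n)} {s : ℕ} (hK : ¬HaltsOn M G T K)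
    (hs : P.numSolutions (inducedGraph G K) ≤ s) : T < MvPolynomial.eval ![n, s] p := by
  by_contra! hle
  have hsize : ![(vertexList K).length, P.numSolutions (inducedGraph G K)] ≤ ![n, s] := fun i ↦ by
    fin_cases i
    · exact length_vertexList_le K
    · exact hs
  exact hK ((hM _ (inducedGraph G K)).1.mono ((eval_le_eval_of_le p hsize).trans hle))

include hC

theorem adequate_of_enumeratesWithin (hT : C * (n + 1) ^ k ≤ T) (hB : loopBound M n T 0 ≤ B) :
    Adequate M P G T B where
  enumeratesWithin S := ⟨_, hM _ _⟩
  haltsOn S hS := by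
    have h := hM _ (inducedGraph G S)
    rw [GraphClass.numSolutions_eq_one (GraphClass.isSetOf_inducedGraph_univ.2 hS)] at h
    exact h.1.mono ((hC _ n (length_vertexList_le S)).trans hT)
  length_graphCode_le := by
    unfold loopBound at hB
    omega
  length_stk_le S t ht j := by
    refine (EnumMachine.length_configAt_le _ t j).trans
      (le_trans ?_ ((Nat.le_add_right _ _).trans hB))
    rw [length_graphCode]
    gcongr <;> exact length_vertexList_le S
  length_outputs_le := by
    refine le_trans ?_ ((Nat.le_add_left _ _).trans hB)
    rw [Nat.zero_add, Nat.one_mul]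
    exact Nat.mul_le_mul_right _ (Nat.le_mul_of_pos_left _ n.succ_pos)

theorem enumeratesWithin_or_lt (hP : P.Hereditary) (s : ℕ) :
    (program M C k).machine.EnumeratesWithin P G
      (timeBound M C k n (MvPolynomial.eval ![n, s] p)) ∨
    (s < P.numSolutions G ∧ s < ((program M C k).machine.outputs (graphCode G)
      (timeBound M C k n (MvPolynomial.eval ![n, s] p))).length) := by
  set J := MvPolynomial.eval ![n, s] p
  set T := C * (n + 1) ^ k
  set B := loopBound M n (T + J) J
  have hA : ∀ j ≤ J, Adequate M P G (T + j) B := fun j hj ↦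
    adequate_of_enumeratesWithin hM hC (Nat.le_add_right _ _)
      (loopBound_mono (Nat.add_le_add_left hj T) (Nat.zero_le J))
  have hAJ := hA J le_rfl
  have htime : timeBound M C k n J = cost B (prepare C k : Procedure M) +
    (J * (cost B (stage : Procedure M) + 1) + (cost B (stage : Procedure M) + 1)) + 1 := by
    rw [timeBound, Nat.succ_mul]
  obtain ⟨t₀, ht₀, hstart⟩ := exists_atStage (M := M) (P := P) (G := G)
    hAJ.length_graphCode_le ((Nat.le_add_right T J).trans hAJ.budget_le)
  obtain ⟨t, ht, hdone | ⟨L, hstage, hlen⟩⟩ := hstart.exists_of_le hP hA le_rfl J le_rfl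
  · exact .inl (hdone.mono (by omega))
  obtain ⟨t', ht', hdone | ⟨L', hstage', -, K, hK, hnum⟩⟩ := hstage.step hP hAJ <|
    calc (L.length + (n + 1) * (T + J + 1)) * (n + 1)
      _ ≤ (J + 1) * ((n + 1) * (T + J + 1)) * (n + 1) :=
        Nat.mul_le_mul_right _ <|
          (Nat.add_le_add_right hlen _).trans_eq (Nat.succ_mul J _).symm
      _ ≤ B := Nat.le_add_left _ _
  · exact .inl (hdone.mono (by omega))
  have hs : s < L'.length := by
    by_contra! hle
    exact absurd (lt_eval_of_not_haltsOn hM hK (hnum.trans hle)) (by omega)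
  refine .inr ⟨hs.trans_le hstage'.listsSolutions.length_le, ?_⟩
  calc s < _ := hs
    _ = _ := hstage'.length_outputs.symm
    _ ≤ _ := (EnumMachine.outputs_prefix (by omega)).length_le

end

end IncrementalEnumeration

theorem mainTheorem10 (P : GraphClass) (hP : P.Hereditary) :
    P.SolvableInPolynomialTotalTime ↔ P.SolvableInIncrementalPolynomialTime := by
  refine ⟨fun ⟨M, p, hM⟩ ↦ ?_, fun ⟨M, p, h⟩ ↦ ⟨M, p, fun n G ↦ (h n G).2⟩⟩
  obtain ⟨C, k, hC⟩ := exists_forall_eval_le_mul_pow p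
  obtain ⟨q, hq⟩ := IncrementalEnumeration.isPolynomial_timeBound (M := M) (C := C) (k := k)
    (f := fun n s ↦ MvPolynomial.eval ![n, s] p) ⟨p, fun _ _ ↦ rfl⟩
  have key := fun n (G : SimpleGraph (Fin n)) ↦
    IncrementalEnumeration.enumeratesWithin_or_lt (G := G) hM hC hP
  refine ⟨(IncrementalEnumeration.program M C k).machine, q, fun n G ↦ ⟨fun s _ hs ↦ ?_, ?_⟩⟩
  · rw [hq]
    rcases key n G s with hdone | ⟨-, hlt⟩
    · rwa [hdone.length_outputs]
    · exact hlt.le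
  · rw [hq]
    exact (key n G _).resolve_right fun h ↦ h.1.false
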